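/- **Definitions.** Let $I\subset(0,\infty)$ have $0$ as an accumulation point. All sets are in $\mathbb R^2$ with the Euclidean norm; simply connected sets are non-empty; $V\Subset W$ means that $\overline V$ is compact and contained in $W$. Let $B\subset\mathbb R^2$ be a bounded simply connected open set and $\mathcal L_\hbar\subset B$ ($\hbar\in I$) discrete sets for which there are $\hbar_0,\epsilon_0>0$ and $N_0\ge 1$ with $\hbar^{-N_0}\|\lambda-\mu\|\ge\epsilon_0$ for all $\hbar\in I\cap(0,\hbar_0]$ and all $\lambda\ne\mu$ in $\mathcal L_\hbar$. Let $\Lambda=\mathbb Z^2$ (lattice case) or $\Lambda=\mathbb Z\times\mathbb N$ (half-lattice case, $0\in\mathbb N$). An *asymptotic chart* consists of a bounded open set $U$, smooth maps $G_\hbar:U\to\mathbb R^2$ ($\hbar\in I$), smooth maps $G_0,G_1,\dots:U\to\mathbb R^2$ and constants $C_N>0$ ($N\ge 0$) such that * $G_\hbar\sim G_0+\hbar G_1+\hbar^2G_2+\cdots$ in the $C^\infty$ topology on $U$: for all $N,m$, the derivatives of order $m$ of $G_\hbar-\sum_{k\le N}\hbar^kG_k$ are $O(\hbar^{N+1})$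 as $\hbar\to0$, uniformly on $U$; * $G_0$ is an orientation preserving diffeomorphism from $U$ to a neighborhood of $\overline B$; in the half-lattice case, moreover, $G_0^{-1}(B)$ is convex and contains a point $(x,0)$; * for all $\hbar\in I$ and $\lambda\in\mathcal L_\hbar$ there is $\zeta\in\Lambda$ with $\hbar\zeta\in U$ and $$\|\lambda-G_\hbar(\hbar\zeta)\|\le C_N\hbar^N\quad\text{for all }N\ge0;\qquad(*)$$ * for every open $U_0\Subset G_0^{-1}(B)$ there is $\hbar_1>0$ such that for all $\hbar\in I\cap(0,\hbar_1]$ and $\zeta\in\Lambda$ with $\hbar\zeta\in U_0$ some $\lambda\in\mathcal L_\hbar$ satisfies $(*)$. If a chart exists, $(\mathcal L_\hbar,I,B)$ is an *asymptotic lattice*, respectively *half-lattice*. A *good labelling* associated with a chart is a family of maps $\ell_\hbar:\mathcal L_\hbar\to\mathbb Z^2$ such that, for all $\hbar\in I$ and $\lambda\in\mathcal L_\hbar$, $\zeta=\ell_\hbar(\lambda)$ satisfies $\hbar\zeta\in U$ and $(*)$. A *linear labelling* is a family $\ell_\hbar+\kappa_\hbar$ (lattice), respectively $A\circ\ell_\hbar+\kappa_\hbar$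 (half-lattice), where $\ell_\hbar$ is a good labelling associated with some chart, $\kappa_\hbar\in\mathbb Z^2$, and $A\in\mathrm{SL}(2,\mathbb Z)$ does not depend on $\hbar$. For a half-lattice, the *boundary* is $\mathcal E=G_0(\{y=0\}\cap G_0^{-1}(B))$ (independent of the chart), and $B'\subset B$ is *admissible* if, for some chart, $B'=G_0(K)$ with $K\subset G_0^{-1}(B)$ convex and containing a point $(x,0)$. **Theorem.** Let $B_1,\dots,B_q\subset\mathbb R^2$ be simply connected open sets such that $(\mathcal L^{(i)}_\hbar,I,B_i)$ is an asymptotic lattice for $i\le p$ and an asymptotic half-lattice, with boundary $\mathcal E_i$, for $p<i\le q$. Assume that $\bigcup_iB_i$ is simply connected and that for all $i,j$ with $B_i\cap B_j\neq\emptyset$: * $B_i\cap B_j$ is simply connected, and $\mathcal L^{(i)}_\hbar\cap B_j=\mathcal L^{(j)}_\hbar\cap B_i$ for all $\hbar\in I$; * if $i,j>p$, then $B_i\cap B_j$ is admissible for $(\mathcal L^{(i)}_\hbar,I,B_i)$ and $\mathcal E_i\cap B_j$ is connected. Assume also that for all $i,j,k>p$ with $B_i\cap B_j\cap B_k\ne\emptyset$,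 this set contains a limit of points $\lambda_n\in\mathcal L^{(i)}_{\hbar_n}$ for some sequence $\hbar_n\to0$ in $I$. Let $\tilde B_i\Subset B_i$ be open sets such that the sets $\tilde B_i$, with the families $\mathcal L^{(i)}_\hbar\cap\tilde B_i$, satisfy the same assumptions (those preceding the one on triple intersections), and such that $\tilde B_i$ is admissible for $(\mathcal L^{(i)}_\hbar,I,B_i)$ when $i>p$. Put $\mathcal L_\hbar=\bigcup_i\mathcal L^{(i)}_\hbar$ and $\mathcal S_\hbar=\mathcal L_\hbar\cap\bigcup_i\tilde B_i$. Call a family of maps $\ell_\hbar:\mathcal S_\hbar\to\mathbb Z^2$ ($\hbar\in I$) a *global labelling* if, for every $i$, its restriction to $\mathcal L^{(i)}_\hbar\cap\tilde B_i$ is a linear labelling of $(\mathcal L^{(i)}_\hbar\cap\tilde B_i,I,\tilde B_i)$. Then: 1. A global labelling exists. 2. If two global labellings agree on $\mathcal L^{(i)}_\hbar\cap\tilde B_i$ for one $i$ and all small $\hbar\in I$, then they agree on $\mathcal S_\hbar$ for all small $\hbar\in I$. 3. For every global labelling $\ell_\hbar$ there exist a smooth map $\Phi$ from a neighborhood of $\overline{\bigcup_iB_i}$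 to $\mathbb R^2$, vectors $\nu_\hbar\in\mathbb R^2$ and a constant $K>0$ such that, for all small $\hbar\in I$ and all $\lambda\in\mathcal S_\hbar$, $$\|\Phi(\lambda)-\hbar\,\ell_\hbar(\lambda)-\nu_\hbar\|\le K\hbar.$$ Moreover, there is a global labelling for which this holds, for some $\Phi$ and $K$, with vectors $\nu_\hbar\in\mathbb Z^2$. -/

import Mathlib

open Set Filter Topology
open scoped ContDiff

noncomputable section

/-- The Euclidean plane. -/
abbrev Plane : Type := EuclideanSpace ℝ (Fin 2)

/-- The point `h ζ` of the scaled lattice `h ℤ²`. -/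
def scaledPoint (h : ℝ) (ζ : Fin 2 → ℤ) : Plane :=
  WithLp.toLp 2 (fun i => h * (ζ i : ℝ))

/-- The index set `ℤ × ℕ`, as a subset of `ℤ²`. -/
def upperIndices : Set (Fin 2 → ℤ) := {ζ | 0 ≤ ζ 1}

/-- `V ⋐ W`: the closure of `V` is compact and contained in `W`. -/
def RelCompactIn (V W : Set Plane) : Prop :=
  IsCompact (closure V) ∧ closure V ⊆ W

/-- The data of a chart: a domain `U`, a family of maps `G h`, the coefficients `g 0, g 1, …` of
its asymptotic expansion, and the constants `C N` of the `O(h^∞)` estimates. -/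
structure ChartData where
  U : Set Plane
  G : ℝ → Plane → Plane
  g : ℕ → Plane → Plane
  C : ℕ → ℝ

namespace ChartData

/-- The point `x` equals `G h (h ζ)` up to `O(h^∞)`, with the constants of the chart. -/
def Labels (X : ChartData) (h : ℝ) (ζ : Fin 2 → ℤ) (x : Plane) : Prop :=
  scaledPoint h ζ ∈ X.U ∧ ∀ N : ℕ, ‖x - X.G h (scaledPoint h ζ)‖ ≤ X.C N * h ^ N

/-- The set `G₀⁻¹(B) ⊆ U`. -/
def principalPreimage (X : ChartData) (B : Set Plane) : Set Plane :=
  {ξ | ξ ∈ X.U ∧ X.g 0 ξ ∈ B}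

/-- `G_h = G₀ + h G₁ + h² G₂ + …` in the `C^∞` topology on `U`: all derivatives of all remainders
are bounded, uniformly on `U`, by the corresponding power of `h`. -/
def HasExpansion (X : ChartData) (I : Set ℝ) : Prop :=
  (∀ h ∈ I, ContDiffOn ℝ ∞ (X.G h) X.U) ∧
  (∀ k, ContDiffOn ℝ ∞ (X.g k) X.U) ∧
  ∀ N m : ℕ, ∃ M : ℝ, ∃ h₁ > 0, ∀ h ∈ I, h ≤ h₁ → ∀ ξ ∈ X.U,
    ‖iteratedFDerivWithin ℝ m
        (fun η => X.G h η - ∑ k ∈ Finset.range (N + 1), h ^ k • X.g k η) X.U ξ‖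
      ≤ M * h ^ (N + 1)

/-- `X` is a chart, modelled on `h Λ` with `Λ ⊆ ℤ²`, for the family `L h` in `B`. The inverse
function theorem makes `G₀` a diffeomorphism onto its image. -/
structure IsChart (X : ChartData) (Λ : Set (Fin 2 → ℤ)) (L : ℝ → Set Plane) (I : Set ℝ)
    (B : Set Plane) : Prop where
  isOpen : IsOpen X.U
  isBounded : Bornology.IsBounded X.U
  expansion : X.HasExpansion I
  injOn : InjOn (X.g 0) X.U
  orientation : ∀ ξ ∈ X.U, 0 < (fderiv ℝ (X.g 0) ξ).det
  image_mem : X.g 0 '' X.U ∈ 𝓝ˢ (closure B)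
  C_pos : ∀ N, 0 < X.C N
  exists_index : ∀ h ∈ I, ∀ x ∈ L h, ∃ ζ ∈ Λ, X.Labels h ζ x
  exists_point : ∀ U₀ : Set Plane, IsOpen U₀ → RelCompactIn U₀ (X.principalPreimage B) →
    ∃ h₁ > 0, ∀ h ∈ I, h ≤ h₁ → ∀ ζ ∈ Λ, scaledPoint h ζ ∈ U₀ → ∃ x ∈ L h, X.Labels h ζ x

/-- Asymptotic charts of lattices. -/
def IsLatticeChart (X : ChartData) (L : ℝ → Set Plane) (I : Set ℝ) (B : Set Plane) : Prop :=
  X.IsChart univ L I B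

/-- Asymptotic charts of half-lattices: they are modelled on `ℤ × ℕ`, and `G₀⁻¹(B)` is a convex
set that meets the horizontal axis. -/
def IsHalfLatticeChart (X : ChartData) (L : ℝ → Set Plane) (I : Set ℝ) (B : Set Plane) : Prop :=
  X.IsChart upperIndices L I B ∧ Convex ℝ (X.principalPreimage B) ∧
    ∃ ξ ∈ X.principalPreimage B, ξ 1 = 0

end ChartData

/-- The conditions common to asymptotic lattices and half-lattices. -/
structure IsSeparatedFamily (L : ℝ → Set Plane) (I : Set ℝ) (B : Set Plane) : Prop where
  I_pos : I ⊆ Ioi 0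
  I_accPt : AccPt (0 : ℝ) (𝓟 I)
  isOpen : IsOpen B
  isBounded : Bornology.IsBounded B
  simplyConnected : IsSimplyConnected B
  subset : ∀ h ∈ I, L h ⊆ B
  discrete : ∀ h ∈ I, IsDiscrete (L h)
  separated : ∃ h₀ > 0, ∃ ε₀ > 0, ∃ N₀ : ℕ, 1 ≤ N₀ ∧ ∀ h ∈ I, h ≤ h₀ →
    ∀ x ∈ L h, ∀ y ∈ L h, x ≠ y → ε₀ ≤ (h ^ N₀)⁻¹ * ‖x - y‖

/-- `(L_h, I, B)` is an asymptotic lattice. -/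
def IsAsymptoticLattice (L : ℝ → Set Plane) (I : Set ℝ) (B : Set Plane) : Prop :=
  IsSeparatedFamily L I B ∧ ∃ X : ChartData, X.IsLatticeChart L I B

/-- `(L_h, I, B)` is an asymptotic half-lattice. -/
def IsAsymptoticHalfLattice (L : ℝ → Set Plane) (I : Set ℝ) (B : Set Plane) : Prop :=
  IsSeparatedFamily L I B ∧ ∃ X : ChartData, X.IsHalfLatticeChart L I B

/-- `ℓ` is a good labelling of the family `L h` associated with the chart `X`. Only the values
`ℓ h x` with `h ∈ I` and `x ∈ L h` matter. -/
def IsGoodLabelling (X : ChartData) (L : ℝ → Set Plane) (I : Set ℝ)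
    (ℓ : ℝ → Plane → (Fin 2 → ℤ)) : Prop :=
  ∀ h ∈ I, ∀ x ∈ L h, X.Labels h (ℓ h x) x

/-- Linear labellings of an asymptotic lattice: a good labelling plus a translation that depends
on `h`. -/
def IsLinearLabelling (L : ℝ → Set Plane) (I : Set ℝ) (B : Set Plane)
    (ℓ : ℝ → Plane → (Fin 2 → ℤ)) : Prop :=
  ∃ X : ChartData, X.IsLatticeChart L I B ∧
    ∃ ℓ₀ : ℝ → Plane → (Fin 2 → ℤ), IsGoodLabelling X L I ℓ₀ ∧
      ∃ κ : ℝ → (Fin 2 → ℤ), ∀ h ∈ I, ∀ x ∈ L h, ℓ h x = ℓ₀ h x + κ h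

/-- Linear labellings of an asymptotic half-lattice: a good labelling composed with a fixed
element of `SL(2, ℤ)`, plus a translation that depends on `h`. -/
def IsHalfLinearLabelling (L : ℝ → Set Plane) (I : Set ℝ) (B : Set Plane)
    (ℓ : ℝ → Plane → (Fin 2 → ℤ)) : Prop :=
  ∃ X : ChartData, X.IsHalfLatticeChart L I B ∧
    ∃ ℓ₀ : ℝ → Plane → (Fin 2 → ℤ), IsGoodLabelling X L I ℓ₀ ∧
      ∃ A : Matrix.SpecialLinearGroup (Fin 2) ℤ, ∃ κ : ℝ → (Fin 2 → ℤ),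
        ∀ h ∈ I, ∀ x ∈ L h, ℓ h x = A.1.mulVec (ℓ₀ h x) + κ h

/-- The boundary `G₀({y = 0} ∩ G₀⁻¹(B))` of an asymptotic half-lattice. It does not depend on the
chart. -/
def halfLatticeBoundary (L : ℝ → Set Plane) (I : Set ℝ) (B : Set Plane) : Set Plane :=
  {c | ∃ X : ChartData, X.IsHalfLatticeChart L I B ∧
    ∃ ξ ∈ X.principalPreimage B, ξ 1 = 0 ∧ X.g 0 ξ = c}

/-- `B'` is an admissible domain of the asymptotic half-lattice `(L_h, I, B)`: the image by `G₀`,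
for some chart, of a convex set `K ⊆ G₀⁻¹(B)` that meets the horizontal axis. -/
def IsAdmissibleDomain (L : ℝ → Set Plane) (I : Set ℝ) (B B' : Set Plane) : Prop :=
  ∃ X : ChartData, X.IsHalfLatticeChart L I B ∧
    ∃ K ⊆ X.principalPreimage B, Convex ℝ K ∧ (∃ ξ ∈ K, ξ 1 = 0) ∧ X.g 0 '' K = B'

/-- The limit points, as `h → 0`, of the family `L h`. -/
def limitPoints (L : ℝ → Set Plane) (I : Set ℝ) : Set Plane :=
  {c | ∀ ε > 0, ∃ h ∈ I, h < ε ∧ ∃ x ∈ L h, dist x c < ε}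

/-- The standing assumptions on finitely many asymptotic lattices (the indices `i < p`) and
half-lattices (the indices `i ≥ p`) with the same parameter set `I`. -/
structure IsCompatibleCover (I : Set ℝ) {q : ℕ} (p : ℕ) (B : Fin q → Set Plane)
    (L : Fin q → ℝ → Set Plane) : Prop where
  lattice : ∀ i : Fin q, (i : ℕ) < p → IsAsymptoticLattice (L i) I (B i)
  halfLattice : ∀ i : Fin q, p ≤ (i : ℕ) → IsAsymptoticHalfLattice (L i) I (B i)
  union_simplyConnected : IsSimplyConnected (⋃ i, B i)
  inter_simplyConnected : ∀ i j, (B i ∩ B j).Nonempty → IsSimplyConnected (B i ∩ B j)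
  agree : ∀ i j, (B i ∩ B j).Nonempty → ∀ h ∈ I, L i h ∩ B j = L j h ∩ B i
  inter_admissible : ∀ i j : Fin q, p ≤ (i : ℕ) → p ≤ (j : ℕ) → (B i ∩ B j).Nonempty →
    IsAdmissibleDomain (L i) I (B i) (B i ∩ B j)
  boundary_connected : ∀ i j : Fin q, p ≤ (i : ℕ) → p ≤ (j : ℕ) → (B i ∩ B j).Nonempty →
    IsConnected (halfLatticeBoundary (L i) I (B i) ∩ B j)

/-- The restriction of the family `L h` to `B'`. -/
def restrictFamily (L : ℝ → Set Plane) (B' : Set Plane) : ℝ → Set Plane :=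
  fun h => L h ∩ B'

/-- `ℓ` is a global labelling: its restriction to each piece is a linear labelling. -/
def IsGlobalLabelling (I : Set ℝ) {q : ℕ} (p : ℕ) (B' : Fin q → Set Plane)
    (L : Fin q → ℝ → Set Plane) (ℓ : ℝ → Plane → (Fin 2 → ℤ)) : Prop :=
  (∀ i : Fin q, (i : ℕ) < p → IsLinearLabelling (restrictFamily (L i) (B' i)) I (B' i) ℓ) ∧
  (∀ i : Fin q, p ≤ (i : ℕ) → IsHalfLinearLabelling (restrictFamily (L i) (B' i)) I (B' i) ℓ)

/-- The two families of maps agree on `S h` for all small `h ∈ I`. -/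
def AgreeForSmall (I : Set ℝ) (S : ℝ → Set Plane) (ℓ ℓ' : ℝ → Plane → (Fin 2 → ℤ)) : Prop :=
  ∃ h₁ > 0, ∀ h ∈ I, h ≤ h₁ → ∀ x ∈ S h, ℓ h x = ℓ' h x

/-- For some `K > 0` and all small `h ∈ I`, `‖Φ(x) - h ℓ_h(x) - ν_h‖ ≤ K h` on `S h`. -/
def ApproximatesLabelling (I : Set ℝ) (S : ℝ → Set Plane) (ℓ : ℝ → Plane → (Fin 2 → ℤ))
    (Φ : Plane → Plane) (ν : ℝ → Plane) : Prop :=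
  ∃ K > 0, ∃ h₁ > 0, ∀ h ∈ I, h ≤ h₁ → ∀ x ∈ S h,
    ‖Φ x - scaledPoint h (ℓ h x) - ν h‖ ≤ K * h

/-- `Φ` is smooth on a neighbourhood of `Y`. -/
def IsSmoothNear (Φ : Plane → Plane) (Y : Set Plane) : Prop :=
  ∃ V : Set Plane, IsOpen V ∧ Y ⊆ V ∧ ContDiffOn ℝ ∞ Φ V

end

/-!
A chart `G_h ∼ G₀ + h G₁ + ⋯` determines the label `ζ` of a point `x` up to `o(1)`:
`ζ = h⁻¹ G₀⁻¹(x) + shift x + o(1)`, with `shift` continuous (`ChartData.IsChart.tendsto_label`).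
Only the first two terms of the expansion, and no derivatives of the remainders, are used.

The core is a rigidity statement for two charts of families that coincide on an open set `W` whose
set of limit points is connected (`ChartData.IsPair.exists_affine`). Differences of labels are
integral, so the derivative of `G₀'⁻¹ ∘ G₀` is an integral matrix at all limit points, hence a
constant `A ∈ SL(2, ℤ)`, and `G₀'⁻¹ ∘ G₀` is affine there. The difference between `ζ' - A ζ` at two
points converges to a difference of values of a continuous function that varies by integral
amounts, so it vanishes, and `ζ' = A ζ + κ_h` for small `h`. The argument works on every set at
distance `O(h)` from the limit points in `W`. This reaches the boundary of `W`; for half-lattices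
it is where convexity, that is admissibility, enters (`ChartData.IsChart.isNear_of_convex`).

For a finite cover, the maps `ζ ↦ A ζ + κ_h` form a locally constant cocycle, and a cocycle on a
simply connected open set is a coboundary, because the covering it defines has a section
(`exists_coboundary`). Applied to the linear parts, then to the translations, this glues the labels
(`IsAtlas.exists_gluing`) and gives a global labelling. The notion of a linear labelling also
constrains the values of `h` that are not small; there the constants of the charts are enlarged
until a single label fits all points (`ChartData.IsChart.exists_goodLabelling`).

By rigidity every global labelling is affine in the labels of each chart, and since the cover is
connected, two global labellings differ by one affine map (`IsAtlas.exists_affine_relation`); this is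
uniqueness. The maps `A_i G₀⁻¹ + r_i` approximate the glued labelling locally, and a partition of
unity averages them to `Φ` (`IsAtlas.exists_contDiff_approx`).
-/

/-! ### Locally constant cocycles -/

/-- A family attached to a cover of a preconnected set by nonempty open sets is constant as soon
as it takes the same value on any two members of the cover that meet. -/
theorem IsPreconnected.eq_of_overlap {ι E α : Type*} [TopologicalSpace E] {B : ι → Set E}
    (hB : ∀ i, IsOpen (B i)) (hne : ∀ i, (B i).Nonempty) (hconn : IsPreconnected (⋃ i, B i))
    {T : ι → α} (hT : ∀ i j, (B i ∩ B j).Nonempty → T i = T j) (i j : ι) : T i = T j := by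
  by_contra hij
  set u : Set E := ⋃ k ∈ {k | T k = T i}, B k
  set v : Set E := ⋃ k ∈ {k | T k ≠ T i}, B k
  have hu : IsOpen u := isOpen_biUnion fun k _ => hB k
  have hv : IsOpen v := isOpen_biUnion fun k _ => hB k
  have hcov : (⋃ k, B k) ⊆ u ∪ v := by
    intro x hx
    obtain ⟨k, hk⟩ := mem_iUnion.1 hx
    by_cases h : T k = T i
    · exact Or.inl (mem_biUnion h hk)
    · exact Or.inr (mem_biUnion h hk)
  have hne1 : ((⋃ k, B k) ∩ u).Nonempty := by
    obtain ⟨x, hx⟩ := hne i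
    exact ⟨x, mem_iUnion_of_mem i hx, mem_biUnion (x := i) (rfl : T i = T i) hx⟩
  have hne2 : ((⋃ k, B k) ∩ v).Nonempty := by
    obtain ⟨x, hx⟩ := hne j
    exact ⟨x, mem_iUnion_of_mem j hx, mem_biUnion (x := j) (Ne.symm hij) hx⟩
  obtain ⟨x, -, hxu, hxv⟩ := hconn u v hu hv hcov hne1 hne2
  obtain ⟨k, hk, hxk⟩ := mem_iUnion₂.1 hxu
  obtain ⟨m, hm, hxm⟩ := mem_iUnion₂.1 hxv
  exact hm ((hT m k ⟨x, hxm, hxk⟩).trans hk)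

/-- The principal bundle, with discrete fibre `G`, glued by a locally constant cocycle. -/
noncomputable def cocycleBundle {ι E G : Type*} [TopologicalSpace E] [Group G] [TopologicalSpace G]
    [DiscreteTopology G] (B : ι → Set E) (hB : ∀ i, IsOpen (B i)) (g : ι → ι → G)
    (hg : ∀ i j k, (B i ∩ B j ∩ B k).Nonempty → g i j * g j k = g i k) :
    FiberBundleCore ι (⋃ i, B i : Set E) G where
  baseSet i := Subtype.val ⁻¹' B i
  isOpen_baseSet i := (hB i).preimage continuous_subtype_val
  indexAt x := (mem_iUnion.1 x.2).choose
  mem_baseSet_at x := (mem_iUnion.1 x.2).choose_spec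
  coordChange i j _ v := v * g i j
  coordChange_self i x hx v := by
    have h := hg i i i ⟨x, ⟨hx, hx⟩, hx⟩
    rw [mul_eq_right] at h
    rw [h, mul_one]
  continuousOn_coordChange i j :=
    ((continuous_of_discreteTopology (f := fun v : G => v * g i j)).comp
      continuous_snd).continuousOn
  coordChange_comp i j k x hx v := by
    rw [mul_assoc, hg i j k ⟨x, hx⟩]

/-- A locally constant cocycle on a simply connected open set is a coboundary: the associated
covering has a global section, which is constant over each member of the cover. -/
theorem exists_coboundary {ι E G : Type*} [TopologicalSpace E] [LocallyPathConnectedSpace E] [Group G]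
    (B : ι → Set E) (hB : ∀ i, IsOpen (B i)) (hconn : ∀ i, IsPreconnected (B i))
    (hsc : IsSimplyConnected (⋃ i, B i)) (g : ι → ι → G)
    (hg : ∀ i j k, (B i ∩ B j ∩ B k).Nonempty → g i j * g j k = g i k) :
    ∃ f : ι → G, ∀ i j, (B i ∩ B j).Nonempty → f j = f i * g i j := by
  let : TopologicalSpace G := ⊥
  have : DiscreteTopology G := ⟨rfl⟩
  have : SimplyConnectedSpace (⋃ i, B i : Set E) := hsc
  have : LocallyPathConnectedSpace (⋃ i, B i : Set E) :=
    (isOpen_iUnion hB).locallyPathConnectedSpace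
  set Z := cocycleBundle B hB g hg
  have hcov : IsCoveringMap (Bundle.TotalSpace.proj : Z.TotalSpace → _) :=
    FiberBundle.isCoveringMap (F := G) (E := Z.Fiber)
  obtain ⟨a₀⟩ : Nonempty (⋃ i, B i : Set E) := inferInstance
  obtain ⟨s, ⟨-, hs⟩, -⟩ := hcov.existsUnique_continuousMap_lifts (ContinuousMap.id _) a₀
    (⟨a₀, (1 : G)⟩ : Z.TotalSpace) rfl
  have hproj : ∀ x, (s x).proj = x := fun x => congrFun hs x
  have hcont : ∀ i, IsPreconnected (Subtype.val ⁻¹' B i : Set (⋃ i, B i : Set E)) := by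
    intro i
    rw [← Topology.IsInducing.subtypeVal.isPreconnected_image, Subtype.image_preimage_coe,
      inter_eq_right.2 (subset_iUnion B i)]
    exact hconn i
  have hconst : ∀ i, ∃ c : G, ∀ x : (⋃ i, B i : Set E), (x : E) ∈ B i →
      (Z.localTriv i (s x)).2 = c := by
    intro i
    rcases (B i).eq_empty_or_nonempty with h0 | ⟨y, hy⟩
    · exact ⟨1, fun x hx => absurd hx (by simp [h0])⟩
    · refine ⟨(Z.localTriv i (s ⟨y, mem_iUnion_of_mem i hy⟩)).2, fun x hx => ?_⟩
      refine (hcont i).constant (f := fun x => (Z.localTriv i (s x)).2) ?_ hx hy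
      refine continuous_snd.comp_continuousOn ?_
      refine (Z.localTriv i).continuousOn_toFun.comp s.continuous.continuousOn ?_
      intro x hx
      refine (Z.mem_localTriv_source i (s x)).2 ?_
      rw [hproj x]
      exact hx
  choose f hf using hconst
  refine ⟨f, fun i j ⟨x, hxi, hxj⟩ => ?_⟩
  have hx : x ∈ ⋃ i, B i := mem_iUnion_of_mem i hxi
  have h1 := hf i ⟨x, hx⟩ hxi
  have h2 := hf j ⟨x, hx⟩ hxj
  rw [← h1, ← h2, Z.localTriv_apply, Z.localTriv_apply]
  have hmem : x ∈ B (Z.indexAt (s ⟨x, hx⟩).proj) := by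
    rw [hproj]
    exact Z.mem_baseSet_at ⟨x, hx⟩
  have key : ∀ (v : G) (m : ι), x ∈ B m → v * g m j = v * g m i * g i j := fun v m hm => by
    rw [mul_assoc, hg m i j ⟨x, ⟨hm, hxi⟩, hxj⟩]
  exact key _ _ hmem

/-! ### Integral points and integral matrices -/

/-- An element of `ℤ²`, as a point of the plane. -/
noncomputable def intPoint (ζ : Fin 2 → ℤ) : Plane :=
  WithLp.toLp 2 (fun i => (ζ i : ℝ))

@[simp] theorem intPoint_apply (ζ : Fin 2 → ℤ) (i : Fin 2) : intPoint ζ i = ζ i := rfl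

theorem intPoint_add (ζ η : Fin 2 → ℤ) : intPoint (ζ + η) = intPoint ζ + intPoint η := by
  ext i; simp

theorem intPoint_sub (ζ η : Fin 2 → ℤ) : intPoint (ζ - η) = intPoint ζ - intPoint η := by
  ext i; simp

theorem scaledPoint_eq_smul (h : ℝ) (ζ : Fin 2 → ℤ) : scaledPoint h ζ = h • intPoint ζ := by
  ext i; simp [scaledPoint]

theorem isClosedEmbedding_intPoint : IsClosedEmbedding intPoint := by
  have h1 : IsClosedEmbedding (Pi.map fun _ : Fin 2 => ((↑) : ℤ → ℝ)) :=
    IsClosedEmbedding.piMap fun _ => Int.isClosedEmbedding_coe_real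
  exact (EuclideanSpace.equiv (Fin 2) ℝ).symm.toHomeomorph.isClosedEmbedding.comp h1

theorem isDiscrete_range_intPoint : IsDiscrete (range intPoint) := by
  rw [isDiscrete_iff_discreteTopology]
  exact isClosedEmbedding_intPoint.isEmbedding.toHomeomorph.symm.isEmbedding.discreteTopology

/-- A convergent family of integral points is eventually constant. -/
theorem exists_eventually_eq_of_tendsto_intPoint {α : Type*} {l : Filter α} [l.NeBot]
    {ζ : α → Fin 2 → ℤ} {v : Plane} (hv : Tendsto (fun a => intPoint (ζ a)) l (𝓝 v)) :
    ∃ η, v = intPoint η ∧ ∀ᶠ a in l, ζ a = η := by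
  obtain ⟨η, rfl⟩ : v ∈ range intPoint :=
    isClosedEmbedding_intPoint.isClosed_range.mem_of_tendsto hv
      (Eventually.of_forall fun a => mem_range_self _)
  refine ⟨η, rfl, ?_⟩
  have := (isClosedEmbedding_intPoint.isInducing.tendsto_nhds_iff (f := ζ) (y := η)).2 hv
  rwa [nhds_discrete, tendsto_pure] at this

/-- An integral matrix, acting on the plane. -/
noncomputable def intMap (A : Matrix (Fin 2) (Fin 2) ℤ) : Plane →L[ℝ] Plane :=
  LinearMap.toContinuousLinearMap (Matrix.toLpLin 2 2 (A.map (Int.castRingHom ℝ)))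

theorem intMap_intPoint (A : Matrix (Fin 2) (Fin 2) ℤ) (ζ : Fin 2 → ℤ) :
    intMap A (intPoint ζ) = intPoint (A.mulVec ζ) := by
  ext i
  fin_cases i <;> simp [intMap, intPoint, Matrix.mulVec, dotProduct]

theorem det_intMap (A : Matrix (Fin 2) (Fin 2) ℤ) : (intMap A).det = (A.det : ℝ) := by
  rw [ContinuousLinearMap.det, intMap, LinearMap.coe_toContinuousLinearMap, LinearMap.det_toLpLin]
  exact (RingHom.map_det (Int.castRingHom ℝ) A).symm

theorem eq_intMap_of_single {T : Plane →L[ℝ] Plane} {A : Matrix (Fin 2) (Fin 2) ℤ}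
    (h : ∀ k, T (intPoint (Pi.single k 1)) = intPoint (A.col k)) : T = intMap A := by
  have hb : ∀ k, T (intPoint (Pi.single k 1)) = intMap A (intPoint (Pi.single k 1)) := by
    intro k
    rw [h, intMap_intPoint, Matrix.mulVec_single_one]
  ext1 x
  have hx : x = x 0 • intPoint (Pi.single 0 1) + x 1 • intPoint (Pi.single 1 1) := by
    ext i; fin_cases i <;> simp
  rw [hx]
  simp only [map_add, map_smul, hb]

theorem intMap_injective : Function.Injective intMap := by
  intro A A' h
  ext i k
  have := congrArg (fun T : Plane →L[ℝ] Plane => T (intPoint (Pi.single k 1)) i) h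
  simpa [intMap_intPoint] using this

theorem intMap_mul (A A' : Matrix (Fin 2) (Fin 2) ℤ) :
    intMap (A * A') = (intMap A).comp (intMap A') := by
  symm
  apply eq_intMap_of_single
  intro k
  rw [ContinuousLinearMap.comp_apply, intMap_intPoint, intMap_intPoint, Matrix.mulVec_mulVec,
    Matrix.mulVec_single_one]

theorem intMap_one : intMap 1 = ContinuousLinearMap.id ℝ Plane := by
  symm
  apply eq_intMap_of_single
  intro k
  rw [ContinuousLinearMap.id_apply, ← Matrix.mulVec_single_one, Matrix.one_mulVec]

/-! ### Difference quotients -/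

/-- Difference quotients at scale `h` of a strictly differentiable map. -/
theorem HasStrictFDerivAt.tendsto_inv_smul_sub {E F : Type*} [NormedAddCommGroup E]
    [NormedSpace ℝ E] [NormedAddCommGroup F] [NormedSpace ℝ F] {f : E → F} {f' : E →L[ℝ] F}
    {x : E} (hf : HasStrictFDerivAt f f' x) {α : Type*} {l : Filter α} {u v : α → E} {h : α → ℝ}
    {w : E} (hu : Tendsto u l (𝓝 x)) (hv : Tendsto v l (𝓝 x))
    (hw : Tendsto (fun a => (h a)⁻¹ • (u a - v a)) l (𝓝 w)) :
    Tendsto (fun a => (h a)⁻¹ • (f (u a) - f (v a))) l (𝓝 (f' w)) := by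
  have h1 : (fun a => f (u a) - f (v a) - f' (u a - v a)) =o[l] fun a => u a - v a :=
    hf.isLittleO.comp_tendsto (hu.prodMk_nhds hv)
  have h2 : (fun a => (h a)⁻¹ • (f (u a) - f (v a) - f' (u a - v a))) =o[l]
      fun a => (h a)⁻¹ • (u a - v a) :=
    (Asymptotics.isBigO_refl (fun a => (h a)⁻¹) l).smul_isLittleO h1
  have h3 : Tendsto (fun a => (h a)⁻¹ • (f (u a) - f (v a) - f' (u a - v a))) l (𝓝 0) := by
    rw [← Asymptotics.isLittleO_one_iff ℝ]
    exact h2.trans_isBigO (hw.isBigO_one ℝ)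
  have h4 := h3.add ((f'.continuous.tendsto w).comp hw)
  rw [zero_add] at h4
  refine h4.congr fun a => ?_
  simp [smul_sub]

/-- A map whose strict derivative vanishes is `o(h)` at scale `h`. -/
theorem HasStrictFDerivAt.tendsto_inv_smul_sub_zero {E F : Type*} [NormedAddCommGroup E]
    [NormedSpace ℝ E] [NormedAddCommGroup F] [NormedSpace ℝ F] {f : E → F}
    {x : E} (hf : HasStrictFDerivAt f (0 : E →L[ℝ] F) x) {α : Type*} {l : Filter α} {u v : α → E}
    {h : α → ℝ} (hu : Tendsto u l (𝓝 x)) (hv : Tendsto v l (𝓝 x))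
    (hw : (fun a => u a - v a) =O[l] h) :
    Tendsto (fun a => (h a)⁻¹ • (f (u a) - f (v a))) l (𝓝 0) := by
  have h1 : (fun a => f (u a) - f (v a)) =o[l] fun a => u a - v a := by
    simpa [Function.comp_def] using hf.isLittleO.comp_tendsto (hu.prodMk_nhds hv)
  have h2 : (fun a => (h a)⁻¹ • (f (u a) - f (v a))) =o[l] fun a => (h a)⁻¹ • h a :=
    (Asymptotics.isBigO_refl (fun a => (h a)⁻¹) l).smul_isLittleO (h1.trans_isBigO hw)
  rw [← Asymptotics.isLittleO_one_iff ℝ]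
  refine h2.trans_isBigO (Asymptotics.IsBigO.of_bound 1 (Eventually.of_forall fun a => ?_))
  rcases eq_or_ne (h a) 0 with h0 | h0 <;> simp [h0]

/-! ### Inverse of the principal part of a chart -/

theorem isOpen_image_of_det_ne_zero {f : Plane → Plane} {U : Set Plane} (hU : IsOpen U)
    (hf : ContDiffOn ℝ ∞ f U) (hdet : ∀ x ∈ U, (fderiv ℝ f x).det ≠ 0) : IsOpen (f '' U) := by
  rw [isOpen_iff_mem_nhds]
  rintro _ ⟨x, hx, rfl⟩
  have hs : HasStrictFDerivAt f (fderiv ℝ f x) x :=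
    (hf.contDiffAt (hU.mem_nhds hx)).hasStrictFDerivAt (by simp)
  rw [← ContinuousLinearMap.coe_toContinuousLinearEquivOfDetNeZero _ (hdet x hx)] at hs
  rw [← hs.map_nhds_eq_of_equiv]
  exact image_mem_map (hU.mem_nhds hx)

theorem contDiffOn_invFunOn {f : Plane → Plane} {U : Set Plane} (hU : IsOpen U)
    (hf : ContDiffOn ℝ ∞ f U) (hinj : InjOn f U) (hdet : ∀ x ∈ U, (fderiv ℝ f x).det ≠ 0) :
    ContDiffOn ℝ ∞ (Function.invFunOn f U) (f '' U) := by
  have hopen : IsOpenMap (U.domRestrict f) := by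
    intro V hV
    have hV' : IsOpen (Subtype.val '' V) := hU.isOpenMap_subtype_val V hV
    have hsub : Subtype.val '' V ⊆ U := by
      rintro _ ⟨x, -, rfl⟩
      exact x.2
    have := isOpen_image_of_det_ne_zero hV' (hf.mono hsub) fun x hx => hdet x (hsub hx)
    rwa [image_image] at this
  let e : OpenPartialHomeomorph Plane Plane :=
    OpenPartialHomeomorph.ofContinuousOpenRestrict (hinj.toPartialEquiv f U) hf.continuousOn hopen hU
  intro y hy
  obtain ⟨x, hx, rfl⟩ := hy
  have hs : e.symm (f x) = x := e.left_inv hx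
  have hc : ContDiffAt ℝ ∞ f x := hf.contDiffAt (hU.mem_nhds hx)
  refine ContDiffAt.contDiffWithinAt (e.contDiffAt_symm
    (f₀' := (fderiv ℝ f x).toContinuousLinearEquivOfDetNeZero (hdet x hx))
    (e.map_source hx) ?_ ?_)
  · rw [hs]
    exact (hc.differentiableAt (by simp)).hasFDerivAt
  · rw [hs]
    exact hc

/-! ### Asymptotic coordinates of a chart -/

namespace ChartData

/-- The inverse `G₀⁻¹` of the principal part of a chart, a map on `G₀(U)`. -/
noncomputable def coord (X : ChartData) : Plane → Plane := Function.invFunOn (X.g 0) X.U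

/-- The first order term in the expansion of the label of a point `x`, which is
`h⁻¹ G₀⁻¹(x) + shift x + o(1)`. -/
noncomputable def shift (X : ChartData) (x : Plane) : Plane :=
  -(fderiv ℝ X.coord x (X.g 1 (X.coord x)))

namespace IsChart

variable {X : ChartData} {Λ : Set (Fin 2 → ℤ)} {L : ℝ → Set Plane} {I : Set ℝ} {B : Set Plane}

theorem contDiffOn_g (hX : X.IsChart Λ L I B) (k : ℕ) : ContDiffOn ℝ ∞ (X.g k) X.U :=
  hX.expansion.2.1 k

theorem isOpen_image (hX : X.IsChart Λ L I B) : IsOpen (X.g 0 '' X.U) :=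
  isOpen_image_of_det_ne_zero hX.isOpen (hX.contDiffOn_g 0) fun x hx => (hX.orientation x hx).ne'

theorem contDiffOn_coord (hX : X.IsChart Λ L I B) : ContDiffOn ℝ ∞ X.coord (X.g 0 '' X.U) :=
  contDiffOn_invFunOn hX.isOpen (hX.contDiffOn_g 0) hX.injOn fun x hx => (hX.orientation x hx).ne'

theorem closure_subset (hX : X.IsChart Λ L I B) : closure B ⊆ X.g 0 '' X.U :=
  subset_of_mem_nhdsSet hX.image_mem

theorem subset_image (hX : X.IsChart Λ L I B) : B ⊆ X.g 0 '' X.U :=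
  subset_closure.trans hX.closure_subset

theorem coord_g (hX : X.IsChart Λ L I B) {ξ : Plane} (hξ : ξ ∈ X.U) : X.coord (X.g 0 ξ) = ξ :=
  hX.injOn.leftInvOn_invFunOn hξ

theorem contDiffAt_g (hX : X.IsChart Λ L I B) (k : ℕ) {ξ : Plane} (hξ : ξ ∈ X.U) :
    ContDiffAt ℝ ∞ (X.g k) ξ :=
  (hX.contDiffOn_g k).contDiffAt (hX.isOpen.mem_nhds hξ)

theorem contDiffAt_coord (hX : X.IsChart Λ L I B) {x : Plane} (hx : x ∈ X.g 0 '' X.U) :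
    ContDiffAt ℝ ∞ X.coord x :=
  hX.contDiffOn_coord.contDiffAt (hX.isOpen_image.mem_nhds hx)

theorem continuousAt_coord (hX : X.IsChart Λ L I B) {x : Plane} (hx : x ∈ X.g 0 '' X.U) :
    ContinuousAt X.coord x :=
  (hX.contDiffAt_coord hx).continuousAt

theorem continuousAt_shift (hX : X.IsChart Λ L I B) {x : Plane} (hx : x ∈ X.g 0 '' X.U) :
    ContinuousAt X.shift x := by
  have h1 : ContinuousAt (fderiv ℝ X.coord) x :=
    (hX.contDiffAt_coord hx).continuousAt_fderiv (by simp)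
  have h2 : ContinuousAt (fun y => X.g 1 (X.coord y)) x := by
    refine ContinuousAt.comp (f := X.coord) ?_ (hX.continuousAt_coord hx)
    exact (hX.contDiffAt_g 1 (Function.invFunOn_mem hx)).continuousAt
  exact (h1.clm_apply h2).neg

end IsChart

theorem coord_mem {X : ChartData} {x : Plane} (hx : x ∈ X.g 0 '' X.U) : X.coord x ∈ X.U :=
  Function.invFunOn_mem hx

theorem g_coord {X : ChartData} {x : Plane} (hx : x ∈ X.g 0 '' X.U) : X.g 0 (X.coord x) = x :=
  Function.invFunOn_eq hx

namespace IsChart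

variable {X : ChartData} {Λ : Set (Fin 2 → ℤ)} {L : ℝ → Set Plane} {I : Set ℝ} {B : Set Plane}

/-- The expansion of `G_h` to order zero, uniformly on `U`. -/
theorem exists_bound_zero (hX : X.IsChart Λ L I B) :
    ∃ M : ℝ, ∀ᶠ h in 𝓝[I] 0, ∀ ξ ∈ X.U, ‖X.G h ξ - X.g 0 ξ‖ ≤ M * h := by
  obtain ⟨M, h₁, hpos, hM⟩ := hX.expansion.2.2 0 0
  refine ⟨M, ?_⟩
  filter_upwards [self_mem_nhdsWithin, mem_nhdsWithin_of_mem_nhds (Iic_mem_nhds hpos)]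
    with h hh hle ξ hξ
  simpa using hM h hh hle ξ hξ

/-- The expansion of `G_h` to order one, uniformly on `U`. -/
theorem exists_bound_one (hX : X.IsChart Λ L I B) :
    ∃ M : ℝ, ∀ᶠ h in 𝓝[I] 0, ∀ ξ ∈ X.U, ‖X.G h ξ - X.g 0 ξ - h • X.g 1 ξ‖ ≤ M * h ^ 2 := by
  obtain ⟨M, h₁, hpos, hM⟩ := hX.expansion.2.2 1 0
  refine ⟨M, ?_⟩
  filter_upwards [self_mem_nhdsWithin, mem_nhdsWithin_of_mem_nhds (Iic_mem_nhds hpos)]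
    with h hh hle ξ hξ
  simpa [Finset.sum_range_succ, sub_sub] using hM h hh hle ξ hξ

/-- A labelled point is at distance `O(h)` from the image of its scaled label. -/
theorem exists_norm_sub_le (hX : X.IsChart Λ L I B) (hI : I ⊆ Ioi 0) :
    ∃ M > 0, ∀ᶠ h in 𝓝[I] 0, ∀ x ζ, X.Labels h ζ x →
      ‖x - X.g 0 (scaledPoint h ζ)‖ ≤ M * h := by
  obtain ⟨M, hM⟩ := hX.exists_bound_zero
  refine ⟨|M| + X.C 1, add_pos_of_nonneg_of_pos (abs_nonneg _) (hX.C_pos 1), ?_⟩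
  filter_upwards [hM, self_mem_nhdsWithin] with h hh hhI x ζ hl
  have hpos : 0 < h := hI hhI
  have h1 := hl.2 1
  have h2 := hh _ hl.1
  have h3 : M * h ≤ |M| * h := mul_le_mul_of_nonneg_right (le_abs_self M) hpos.le
  calc ‖x - X.g 0 (scaledPoint h ζ)‖
      = ‖(x - X.G h (scaledPoint h ζ)) + (X.G h (scaledPoint h ζ) - X.g 0 (scaledPoint h ζ))‖ := by
        rw [sub_add_sub_cancel]
    _ ≤ X.C 1 * h ^ 1 + M * h := (norm_add_le _ _).trans (add_le_add h1 h2)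
    _ ≤ (|M| + X.C 1) * h := by linarith

section Limits

variable {α : Type*} {l : Filter α} {h : α → ℝ} {x : α → Plane} {ζ : α → Fin 2 → ℤ} {x₀ : Plane}

theorem tendsto_sub_zero (hX : X.IsChart Λ L I B) (hI : I ⊆ Ioi 0)
    (hh : Tendsto h l (𝓝[I] 0)) (hl : ∀ᶠ a in l, X.Labels (h a) (ζ a) (x a)) :
    Tendsto (fun a => x a - X.g 0 (scaledPoint (h a) (ζ a))) l (𝓝 0) := by
  obtain ⟨M, -, hM⟩ := hX.exists_norm_sub_le hI
  have h0 : Tendsto (fun a => M * h a) l (𝓝 0) := by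
    simpa using (hh.mono_right nhdsWithin_le_nhds).const_mul M
  refine squeeze_zero_norm' ?_ h0
  filter_upwards [hh.eventually hM, hl] with a ha hla
  exact ha _ _ hla

theorem tendsto_scaledPoint (hX : X.IsChart Λ L I B) (hI : I ⊆ Ioi 0)
    (hh : Tendsto h l (𝓝[I] 0)) (hx₀ : x₀ ∈ X.g 0 '' X.U) (hx : Tendsto x l (𝓝 x₀))
    (hl : ∀ᶠ a in l, X.Labels (h a) (ζ a) (x a)) :
    Tendsto (fun a => scaledPoint (h a) (ζ a)) l (𝓝 (X.coord x₀)) := by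
  have h1 : Tendsto (fun a => X.g 0 (scaledPoint (h a) (ζ a))) l (𝓝 x₀) := by
    simpa using hx.sub (hX.tendsto_sub_zero hI hh hl)
  refine ((hX.continuousAt_coord hx₀).tendsto.comp h1).congr' ?_
  filter_upwards [hl] with a ha
  exact hX.coord_g ha.1

/-- The label of a point `x` is `h⁻¹ G₀⁻¹(x) + shift x + o(1)` as `h → 0`. -/
theorem tendsto_label (hX : X.IsChart Λ L I B) (hI : I ⊆ Ioi 0)
    (hh : Tendsto h l (𝓝[I] 0)) (hx₀ : x₀ ∈ X.g 0 '' X.U) (hx : Tendsto x l (𝓝 x₀))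
    (hl : ∀ᶠ a in l, X.Labels (h a) (ζ a) (x a)) :
    Tendsto (fun a => intPoint (ζ a) - (h a)⁻¹ • X.coord (x a)) l (𝓝 (X.shift x₀)) := by
  have hξ := hX.tendsto_scaledPoint hI hh hx₀ hx hl
  have hy : Tendsto (fun a => X.g 0 (scaledPoint (h a) (ζ a))) l (𝓝 x₀) := by
    simpa using hx.sub (hX.tendsto_sub_zero hI hh hl)
  have hpos : ∀ᶠ a in l, 0 < h a :=
    (hh.eventually self_mem_nhdsWithin).mono fun a ha => hI ha
  obtain ⟨M, hM⟩ := hX.exists_bound_one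
  have h1 : Tendsto (fun a => (h a)⁻¹ • (x a - X.g 0 (scaledPoint (h a) (ζ a)))) l
      (𝓝 (X.g 1 (X.coord x₀))) := by
    have hg1 := (hX.contDiffAt_g 1 (coord_mem hx₀)).continuousAt.tendsto.comp hξ
    have hzero : Tendsto (fun a => (M + X.C 2) * h a) l (𝓝 0) := by
      simpa using (hh.mono_right nhdsWithin_le_nhds).const_mul (M + X.C 2)
    have hr : Tendsto (fun a => (h a)⁻¹ • (x a - X.g 0 (scaledPoint (h a) (ζ a)))
        - X.g 1 (scaledPoint (h a) (ζ a))) l (𝓝 0) := by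
      refine squeeze_zero_norm' ?_ hzero
      filter_upwards [hpos, hh.eventually hM, hl] with a ha hMa hla
      set ξ := scaledPoint (h a) (ζ a)
      have e : (h a)⁻¹ • (x a - X.g 0 ξ) - X.g 1 ξ
          = (h a)⁻¹ • ((x a - X.G (h a) ξ) + (X.G (h a) ξ - X.g 0 ξ - h a • X.g 1 ξ)) := by
        rw [smul_add, smul_sub, smul_sub, smul_sub, smul_sub, smul_smul, inv_mul_cancel₀ ha.ne',
          one_smul]
        abel
      rw [e, norm_smul, norm_inv, Real.norm_of_nonneg ha.le, inv_mul_le_iff₀ ha]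
      refine (norm_add_le _ _).trans ((add_le_add (hla.2 2) (hMa ξ hla.1)).trans (le_of_eq ?_))
      ring
    simpa using hr.add hg1
  have hs : HasStrictFDerivAt X.coord (fderiv ℝ X.coord x₀) x₀ :=
    (hX.contDiffAt_coord hx₀).hasStrictFDerivAt (by simp)
  refine (hs.tendsto_inv_smul_sub hx hy h1).neg.congr' ?_
  filter_upwards [hpos, hl] with a ha hla
  rw [hX.coord_g hla.1, smul_sub, neg_sub]
  conv_lhs => rw [scaledPoint_eq_smul, smul_smul, inv_mul_cancel₀ ha.ne', one_smul]

end Limits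

end IsChart

end ChartData

/-! ### Limit points of lattices and half-lattices -/

/-- The index set `Λ ⊆ ℤ²` is modelled on the closed convex set `H`: its scaled points lie in `H`,
and they come close to every point of `H`, together with their neighbours in the positive
directions. The two instances are `ℤ²` in the plane and `ℤ × ℕ` in the upper half-plane. -/
structure IsIndexModel (Λ : Set (Fin 2 → ℤ)) (H : Set Plane) : Prop where
  isClosed : IsClosed H
  convex : Convex ℝ H
  scaledPoint_mem : ∀ h > 0, ∀ ζ ∈ Λ, scaledPoint h ζ ∈ H
  floor_add_mem : ∀ h > 0, ∀ ξ ∈ H, ∀ v : Fin 2 → ℤ, 0 ≤ v → (fun i => ⌊ξ i / h⌋) + v ∈ Λ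

theorem isIndexModel_univ : IsIndexModel univ univ :=
  ⟨isClosed_univ, convex_univ, fun _ _ _ _ => trivial, fun _ _ _ _ _ _ => trivial⟩

/-- The closed upper half-plane. -/
def upperHalf : Set Plane := {ξ | 0 ≤ ξ 1}

theorem isIndexModel_upper : IsIndexModel upperIndices upperHalf where
  isClosed := isClosed_le continuous_const (by fun_prop)
  convex := by
    intro x hx y hy a b ha hb _
    have hx' : 0 ≤ x 1 := hx
    have hy' : 0 ≤ y 1 := hy
    change 0 ≤ a * x 1 + b * y 1
    positivity
  scaledPoint_mem h hh ζ hζ := by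
    have : (0 : ℝ) ≤ ζ 1 := by exact_mod_cast (show 0 ≤ ζ 1 from hζ)
    change 0 ≤ h * (ζ 1 : ℝ)
    positivity
  floor_add_mem h hh ξ hξ v hv := by
    have hξ' : 0 ≤ ξ 1 := hξ
    have h1 : 0 ≤ ⌊ξ 1 / h⌋ := Int.floor_nonneg.2 (by positivity)
    exact add_nonneg h1 (hv 1)

theorem tendsto_scaledPoint_floor {I : Set ℝ} (hI : I ⊆ Ioi 0) (ξ : Plane) (v : Fin 2 → ℤ) :
    Tendsto (fun h => scaledPoint h ((fun i => ⌊ξ i / h⌋) + v)) (𝓝[I] 0) (𝓝 ξ) := by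
  have key : Tendsto (fun h : ℝ => fun i : Fin 2 => h * (((⌊ξ i / h⌋ + v i : ℤ)) : ℝ)) (𝓝[I] 0)
      (𝓝 (fun i => ξ i)) := by
    rw [tendsto_pi_nhds]
    intro i
    have h0 : Tendsto (fun h : ℝ => h) (𝓝[I] 0) (𝓝 0) := nhdsWithin_le_nhds
    have h1 : Tendsto (fun h : ℝ => ξ i - h + h * v i) (𝓝[I] 0) (𝓝 (ξ i)) := by
      simpa using (tendsto_const_nhds.sub h0).add (h0.mul_const (v i : ℝ))
    have h2 : Tendsto (fun h : ℝ => ξ i + h * v i) (𝓝[I] 0) (𝓝 (ξ i)) := by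
      simpa using (tendsto_const_nhds (x := ξ i)).add (h0.mul_const (v i : ℝ))
    refine tendsto_of_tendsto_of_tendsto_of_le_of_le' h1 h2 ?_ ?_
    · filter_upwards [self_mem_nhdsWithin] with h hh
      have hpos : 0 < h := hI hh
      have := (div_lt_iff₀ hpos).1 (Int.lt_floor_add_one (ξ i / h))
      push_cast
      linarith
    · filter_upwards [self_mem_nhdsWithin] with h hh
      have hpos : 0 < h := hI hh
      have := (le_div_iff₀ hpos).1 (Int.floor_le (ξ i / h))
      push_cast
      linarith
  exact ((PiLp.continuous_toLp 2 (fun _ : Fin 2 => ℝ)).tendsto _).comp key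

namespace ChartData

namespace IsChart

variable {X : ChartData} {Λ : Set (Fin 2 → ℤ)} {H : Set Plane} {L : ℝ → Set Plane} {I : Set ℝ}
  {B : Set Plane}

/-- Near a point `x` whose coordinate lies in the model domain, all the labels close to
`h⁻¹ G₀⁻¹(x)` are attained, when `h` is small. -/
theorem exists_labelled (hX : X.IsChart Λ L I B) (hI : I ⊆ Ioi 0) (hΛ : IsIndexModel Λ H)
    {x : Plane} (hx : B ∈ 𝓝 x) (hxH : X.coord x ∈ H) {v : Fin 2 → ℤ} (hv : 0 ≤ v) :
    ∃ y : ℝ → Plane, Tendsto y (𝓝[I] 0) (𝓝 x) ∧ ∀ᶠ h in 𝓝[I] 0,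
      y h ∈ L h ∧ X.Labels h ((fun i => ⌊X.coord x i / h⌋) + v) (y h) := by
  have hxO : x ∈ X.g 0 '' X.U := hX.subset_image (mem_of_mem_nhds hx)
  have hU := hX.isOpen.mem_nhds (coord_mem hxO)
  have hc := (hX.contDiffAt_g 0 (coord_mem hxO)).continuousAt
  have hpre : X.principalPreimage B ∈ 𝓝 (X.coord x) := by
    refine inter_mem hU (hc.preimage_mem_nhds ?_)
    rwa [g_coord hxO]
  obtain ⟨r, hr, hball⟩ := Metric.nhds_basis_closedBall.mem_iff.1 hpre
  obtain ⟨h₁, h₁pos, hh₁⟩ := hX.exists_point (Metric.ball (X.coord x) r) Metric.isOpen_ball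
    ⟨(isCompact_closedBall _ _).of_isClosed_subset isClosed_closure
      Metric.closure_ball_subset_closedBall,
      Metric.closure_ball_subset_closedBall.trans hball⟩
  have hlim := tendsto_scaledPoint_floor hI (X.coord x) v
  have hex : ∀ᶠ h in 𝓝[I] 0, ∃ y ∈ L h, X.Labels h ((fun i => ⌊X.coord x i / h⌋) + v) y := by
    filter_upwards [self_mem_nhdsWithin, mem_nhdsWithin_of_mem_nhds (Iic_mem_nhds h₁pos),
      hlim (Metric.ball_mem_nhds _ hr)] with h hh hle hb
    exact hh₁ h hh hle _ (hΛ.floor_add_mem h (hI hh) _ hxH v hv) hb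
  have hex' : ∀ h, ∃ y, (∃ y ∈ L h, X.Labels h ((fun i => ⌊X.coord x i / h⌋) + v) y) →
      y ∈ L h ∧ X.Labels h ((fun i => ⌊X.coord x i / h⌋) + v) y := fun h => by
    by_cases hy : ∃ y ∈ L h, X.Labels h ((fun i => ⌊X.coord x i / h⌋) + v) y
    · exact ⟨hy.choose, fun _ => hy.choose_spec⟩
    · exact ⟨0, fun h' => absurd h' hy⟩
  choose y hy using hex'
  have hy' := hex.mono fun h hh => hy h hh
  refine ⟨y, ?_, hy'⟩
  have h0 := hX.tendsto_sub_zero (h := fun h => h) (l := 𝓝[I] 0) hI tendsto_id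
    (hy'.mono fun h hh => hh.2)
  have h1 := hc.tendsto.comp hlim
  rw [g_coord hxO] at h1
  simpa using h0.add h1

/-- The limit points of the family inside `B` are the points whose coordinate lies in the model
domain. -/
theorem mem_limitPoints_iff (hX : X.IsChart Λ L I B) (hI : I ⊆ Ioi 0) [(𝓝[I] (0 : ℝ)).NeBot]
    (hΛ : IsIndexModel Λ H) {x : Plane} (hx : B ∈ 𝓝 x) :
    x ∈ limitPoints L I ↔ X.coord x ∈ H := by
  constructor
  · intro hlim
    choose h hhI hlt y hyL hdist using fun n : ℕ => hlim (1 / ((n : ℝ) + 1)) (by positivity)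
    choose ζ hζΛ hζ using fun n => hX.exists_index (h n) (hhI n) (y n) (hyL n)
    have hh : Tendsto h atTop (𝓝[I] 0) := by
      refine tendsto_nhdsWithin_iff.2 ⟨?_, Eventually.of_forall hhI⟩
      exact squeeze_zero (fun n => (hI (hhI n)).le) (fun n => (hlt n).le)
        tendsto_one_div_add_atTop_nhds_zero_nat
    have hy : Tendsto y atTop (𝓝 x) := by
      rw [tendsto_iff_dist_tendsto_zero]
      exact squeeze_zero (fun n => dist_nonneg) (fun n => (hdist n).le)
        tendsto_one_div_add_atTop_nhds_zero_nat
    refine hΛ.isClosed.mem_of_tendsto (hX.tendsto_scaledPoint hI hh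
      (hX.subset_image (mem_of_mem_nhds hx)) hy (Eventually.of_forall hζ)) ?_
    exact Eventually.of_forall fun n => hΛ.scaledPoint_mem _ (hI (hhI n)) _ (hζΛ n)
  · intro hxH ε hε
    obtain ⟨y, hy, hl⟩ := hX.exists_labelled hI hΛ hx hxH (v := 0) le_rfl
    have hε' : ∀ᶠ h in 𝓝[I] (0 : ℝ), h < ε :=
      mem_nhdsWithin_of_mem_nhds (Iio_mem_nhds hε)
    have hd' : ∀ᶠ h in 𝓝[I] (0 : ℝ), dist (y h) x < ε := hy (Metric.ball_mem_nhds x hε)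
    obtain ⟨h, ⟨⟨hh, hlt⟩, hd⟩, hyL⟩ :=
      (((eventually_mem_nhdsWithin.and hε').and hd').and hl).exists
    exact ⟨h, hh, hlt, y h, hyL.1, hd⟩

end IsChart

end ChartData

/-! ### Comparison of two charts -/

namespace ChartData

/-- The change of coordinates `G₀'⁻¹ ∘ G₀` between two charts. -/
noncomputable def transition (X X' : ChartData) (ξ : Plane) : Plane := X'.coord (X.g 0 ξ)

/-- `X` and `X'` are charts of two families that coincide on an open set `W`. -/
structure IsPair (X X' : ChartData) (Λ Λ' : Set (Fin 2 → ℤ)) (H H' : Set Plane)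
    (L L' : ℝ → Set Plane) (I : Set ℝ) (B B' W : Set Plane) : Prop where
  pos : I ⊆ Ioi 0
  chart : X.IsChart Λ L I B
  chart' : X'.IsChart Λ' L' I B'
  model : IsIndexModel Λ H
  model' : IsIndexModel Λ' H'
  isOpen : IsOpen W
  subset : W ⊆ B
  subset' : W ⊆ B'
  agree : ∀ h ∈ I, L h ∩ W = L' h ∩ W

theorem IsChart.tendsto_label_sub {X : ChartData} {Λ : Set (Fin 2 → ℤ)} {L : ℝ → Set Plane}
    {I : Set ℝ} {B : Set Plane} (hX : X.IsChart Λ L I B) (hI : I ⊆ Ioi 0) {α : Type*}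
    {l : Filter α} {h : α → ℝ} {x y : α → Plane} {ζ η : α → Fin 2 → ℤ} {x₀ : Plane}
    (hh : Tendsto h l (𝓝[I] 0)) (hx₀ : x₀ ∈ X.g 0 '' X.U)
    (hx : Tendsto x l (𝓝 x₀)) (hy : Tendsto y l (𝓝 x₀))
    (hζ : ∀ᶠ a in l, X.Labels (h a) (ζ a) (x a)) (hη : ∀ᶠ a in l, X.Labels (h a) (η a) (y a)) :
    Tendsto (fun a => intPoint (η a - ζ a) - (h a)⁻¹ • (X.coord (y a) - X.coord (x a))) l
      (𝓝 0) := by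
  have h1 := (hX.tendsto_label hI hh hx₀ hy hη).sub (hX.tendsto_label hI hh hx₀ hx hζ)
  rw [sub_self] at h1
  refine h1.congr fun a => ?_
  rw [intPoint_sub, smul_sub]
  abel

theorem IsChart.isBigO_coord_sub {X : ChartData} {Λ : Set (Fin 2 → ℤ)} {L : ℝ → Set Plane}
    {I : Set ℝ} {B : Set Plane} (hX : X.IsChart Λ L I B) (hI : I ⊆ Ioi 0) {α : Type*}
    {l : Filter α} {h : α → ℝ} {x : α → Plane} {ζ : α → Fin 2 → ℤ} {x₀ : Plane}
    (hh : Tendsto h l (𝓝[I] 0)) (hx₀ : x₀ ∈ X.g 0 '' X.U) (hx : Tendsto x l (𝓝 x₀))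
    (hζ : ∀ᶠ a in l, X.Labels (h a) (ζ a) (x a)) :
    (fun a => X.coord (x a) - scaledPoint (h a) (ζ a)) =O[l] h := by
  have h1 := (hX.tendsto_label hI hh hx₀ hx hζ).isBigO_one ℝ
  have h2 := (Asymptotics.isBigO_refl h l).smul h1
  have hpos : ∀ᶠ a in l, 0 < h a :=
    (hh.eventually self_mem_nhdsWithin).mono fun a ha => hI ha
  refine Asymptotics.IsBigO.congr' (h2.neg_left) ?_ (Eventually.of_forall fun a => by simp)
  filter_upwards [hpos] with a ha
  rw [scaledPoint_eq_smul, smul_sub, smul_smul, mul_inv_cancel₀ ha.ne', one_smul, neg_sub]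

namespace IsPair

variable {X X' : ChartData} {Λ Λ' : Set (Fin 2 → ℤ)} {H H' : Set Plane}
    {L L' : ℝ → Set Plane} {I : Set ℝ} {B B' W : Set Plane}

theorem symm (P : IsPair X X' Λ Λ' H H' L L' I B B' W) :
    IsPair X' X Λ' Λ H' H L' L I B' B W :=
  ⟨P.pos, P.chart', P.chart, P.model', P.model, P.isOpen, P.subset', P.subset,
    fun h hh => (P.agree h hh).symm⟩

theorem mem_image (P : IsPair X X' Λ Λ' H H' L L' I B B' W) {x : Plane} (hx : x ∈ W) :
    x ∈ X.g 0 '' X.U :=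
  P.chart.subset_image (P.subset hx)

theorem mem_nhds (P : IsPair X X' Λ Λ' H H' L L' I B B' W) {x : Plane} (hx : x ∈ W) : B ∈ 𝓝 x :=
  mem_of_superset (P.isOpen.mem_nhds hx) P.subset

theorem inter_limitPoints_subset (P : IsPair X X' Λ Λ' H H' L L' I B B' W) :
    W ∩ limitPoints L I ⊆ limitPoints L' I := by
  rintro x ⟨hxW, hx⟩ ε hε
  obtain ⟨r, hr, hball⟩ := Metric.isOpen_iff.1 P.isOpen x hxW
  obtain ⟨h, hh, hlt, y, hy, hd⟩ := hx (min ε r) (lt_min hε hr)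
  have hyW : y ∈ W := hball (hd.trans_le (min_le_right _ _))
  have : y ∈ L' h ∩ W := by
    rw [← P.agree h hh]
    exact ⟨hy, hyW⟩
  exact ⟨h, hh, hlt.trans_le (min_le_left _ _), y, this.1, hd.trans_le (min_le_left _ _)⟩

theorem contDiffAt_transition (P : IsPair X X' Λ Λ' H H' L L' I B B' W) {x : Plane}
    (hx : x ∈ X.g 0 '' X.U) (hx' : x ∈ X'.g 0 '' X'.U) :
    ContDiffAt ℝ ∞ (transition X X') (X.coord x) := by
  have h1 : ContDiffAt ℝ ∞ X'.coord (X.g 0 (X.coord x)) := by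
    rw [g_coord hx]
    exact P.chart'.contDiffAt_coord hx'
  exact h1.comp (X.coord x) (P.chart.contDiffAt_g 0 (coord_mem hx))

/-- The derivative of the change of coordinates has integral entries at the limit points: its
columns are limits of differences of labels. -/
theorem exists_fderiv_eq_intMap (P : IsPair X X' Λ Λ' H H' L L' I B B' W)
    [(𝓝[I] (0 : ℝ)).NeBot] {x : Plane} (hx : x ∈ W) (hxH : X.coord x ∈ H) :
    ∃ A, fderiv ℝ (transition X X') (X.coord x) = intMap A := by
  have hxO := P.mem_image hx
  have hxO' := P.symm.mem_image hx
  have hcol : ∀ k : Fin 2, ∃ η, fderiv ℝ (transition X X') (X.coord x)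
      (intPoint (Pi.single k 1)) = intPoint η := by
    intro k
    obtain ⟨y, hy, hyl⟩ := P.chart.exists_labelled P.pos P.model (P.mem_nhds hx) hxH
      (v := 0) le_rfl
    obtain ⟨z, hz, hzl⟩ := P.chart.exists_labelled P.pos P.model (P.mem_nhds hx) hxH
      (v := Pi.single k 1) (by simp)
    have hlab : ∀ y : ℝ → Plane, Tendsto y (𝓝[I] 0) (𝓝 x) → (∀ᶠ h in 𝓝[I] 0, y h ∈ L h) →
        ∃ ζ : ℝ → Fin 2 → ℤ, ∀ᶠ h in 𝓝[I] 0, X'.Labels h (ζ h) (y h) := by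
      intro y hy hyL
      have : ∀ᶠ h in 𝓝[I] 0, ∃ ζ, X'.Labels h ζ (y h) := by
        filter_upwards [hy (P.isOpen.mem_nhds hx), hyL, self_mem_nhdsWithin] with h hW hL hI
        have hm : y h ∈ L' h ∩ W := by
          rw [← P.agree h hI]
          exact ⟨hL, hW⟩
        obtain ⟨ζ, -, hζ⟩ := P.chart'.exists_index h hI (y h) hm.1
        exact ⟨ζ, hζ⟩
      exact this.choice
    obtain ⟨ζ, hζ⟩ := hlab y hy (hyl.mono fun h hh => hh.1)
    obtain ⟨η, hη⟩ := hlab z hz (hzl.mono fun h hh => hh.1)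
    have h1 := P.chart.tendsto_label_sub P.pos tendsto_id hxO hy hz
      (hyl.mono fun h hh => hh.2) (hzl.mono fun h hh => hh.2)
    have h2 : Tendsto (fun h : ℝ => h⁻¹ • (X.coord (z h) - X.coord (y h))) (𝓝[I] 0)
        (𝓝 (intPoint (Pi.single k 1))) := by
      have := (tendsto_const_nhds (x := intPoint (Pi.single k 1))).sub h1
      rw [sub_zero] at this
      refine this.congr fun h => ?_
      simp
    have hc := (P.chart.continuousAt_coord hxO).tendsto
    have h3 := ((P.contDiffAt_transition hxO hxO').hasStrictFDerivAt
      (by simp)).tendsto_inv_smul_sub (hc.comp hz) (hc.comp hy) h2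
    have h4 := P.chart'.tendsto_label_sub P.pos tendsto_id hxO' hy hz hζ hη
    have h5 : Tendsto (fun h => intPoint (η h - ζ h)) (𝓝[I] 0)
        (𝓝 (fderiv ℝ (transition X X') (X.coord x) (intPoint (Pi.single k 1)))) := by
      have := h4.add h3
      rw [zero_add] at this
      refine this.congr' ?_
      filter_upwards [hy (P.isOpen.mem_nhds hx), hz (P.isOpen.mem_nhds hx)] with h hyW hzW
      simp [transition, g_coord (P.mem_image hyW), g_coord (P.mem_image hzW)]
    obtain ⟨v, hv, -⟩ := exists_eventually_eq_of_tendsto_intPoint h5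
    exact ⟨v, hv⟩
  choose η hη using hcol
  exact ⟨Matrix.of fun i k => η k i, eq_intMap_of_single fun k => by rw [hη]; rfl⟩

/-- The derivative of the change of coordinates is in `SL(2, ℤ)` at the limit points. -/
theorem exists_fderiv_eq (P : IsPair X X' Λ Λ' H H' L L' I B B' W)
    [(𝓝[I] (0 : ℝ)).NeBot] {x : Plane} (hx : x ∈ W ∩ limitPoints L I) :
    ∃ A : Matrix.SpecialLinearGroup (Fin 2) ℤ,
      fderiv ℝ (transition X X') (X.coord x) = intMap A.1 := by
  have hxO := P.mem_image hx.1
  have hxO' := P.symm.mem_image hx.1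
  have hxH := (P.chart.mem_limitPoints_iff P.pos P.model (P.mem_nhds hx.1)).1 hx.2
  have hxH' := (P.chart'.mem_limitPoints_iff P.pos P.model' (P.symm.mem_nhds hx.1)).1
    (P.inter_limitPoints_subset hx)
  obtain ⟨A, hA⟩ := P.exists_fderiv_eq_intMap hx.1 hxH
  obtain ⟨A', hA'⟩ := P.symm.exists_fderiv_eq_intMap hx.1 hxH'
  have hθ : transition X X' (X.coord x) = X'.coord x := by rw [transition, g_coord hxO]
  have hd := ((P.contDiffAt_transition hxO hxO').differentiableAt (by simp)).hasFDerivAt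
  have hd' := ((P.symm.contDiffAt_transition hxO' hxO).differentiableAt (by simp)).hasFDerivAt
  have hg' := ((P.chart'.contDiffAt_g 0 (coord_mem hxO')).differentiableAt (by simp)).hasFDerivAt
  have hnear : ∀ᶠ ξ in 𝓝 (X.coord x), X.g 0 ξ ∈ X'.g 0 '' X'.U ∧ ξ ∈ X.U := by
    refine ((P.chart.contDiffAt_g 0 (coord_mem hxO)).continuousAt.eventually_mem ?_).and
      (P.chart.isOpen.mem_nhds (coord_mem hxO))
    rw [g_coord hxO]
    exact P.chart'.isOpen_image.mem_nhds hxO'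
  have hmul : A' * A = 1 := by
    apply intMap_injective
    rw [intMap_mul, intMap_one, ← hA, ← hA']
    rw [← hθ] at hd'
    have h1 := hd'.comp (X.coord x) hd
    rw [hθ] at h1
    refine h1.unique ((hasFDerivAt_id (X.coord x)).congr_of_eventuallyEq ?_)
    filter_upwards [hnear] with ξ hξ
    simp only [Function.comp_apply, transition, id]
    rw [g_coord hξ.1, P.chart.coord_g hξ.2]
  have hdet : A'.det * A.det = 1 := by rw [← Matrix.det_mul, hmul, Matrix.det_one]
  have hcomp : (fderiv ℝ (X'.g 0) (X'.coord x)).comp (intMap A)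
      = fderiv ℝ (X.g 0) (X.coord x) := by
    rw [← hA]
    rw [← hθ] at hg'
    have h1 := hg'.comp (X.coord x) hd
    rw [hθ] at h1
    refine (h1.congr_of_eventuallyEq ?_).fderiv.symm
    filter_upwards [hnear] with ξ hξ
    simp only [Function.comp_apply, transition]
    rw [g_coord hξ.1]
  have hpos : 0 < A.det := by
    have h1 := P.chart.orientation _ (coord_mem hxO)
    have h2 := P.chart'.orientation _ (coord_mem hxO')
    rw [← hcomp] at h1
    change 0 < LinearMap.det ((fderiv ℝ (X'.g 0) (X'.coord x) : Plane →ₗ[ℝ] Plane) ∘ₗ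
      (intMap A : Plane →ₗ[ℝ] Plane)) at h1
    rw [LinearMap.det_comp] at h1
    have h3 := (mul_pos_iff_of_pos_left h2).1 h1
    have h4 := det_intMap A
    rw [ContinuousLinearMap.det] at h4
    rw [h4] at h3
    exact_mod_cast h3
  have h1 : A.det = 1 := by
    rcases Int.eq_one_or_neg_one_of_mul_eq_one' hdet with h | h <;> omega
  exact ⟨⟨A, h1⟩, hA⟩

end IsPair

end ChartData

namespace ChartData

/-- All points of the family in `V` are, in the coordinates of the chart, at distance `O(h)` from
the set `S`. -/
def IsNear (X : ChartData) (L : ℝ → Set Plane) (I : Set ℝ) (S V : Set Plane) : Prop :=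
  ∃ C : ℝ, ∀ᶠ h in 𝓝[I] (0 : ℝ), ∀ x ∈ L h ∩ V, ∃ y ∈ S, ‖X.coord x - X.coord y‖ ≤ C * h

namespace IsPair

variable {X X' : ChartData} {Λ Λ' : Set (Fin 2 → ℤ)} {H H' : Set Plane}
    {L L' : ℝ → Set Plane} {I : Set ℝ} {B B' W : Set Plane}

theorem tendsto_of_isBigO (P : IsPair X X' Λ Λ' H H' L L' I B B' W) {α : Type*} {l : Filter α}
    {h : α → ℝ} {x y : α → Plane} {x₀ : Plane} (hh : Tendsto h l (𝓝[I] 0))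
    (hx₀ : x₀ ∈ X.g 0 '' X.U) (hx : Tendsto x l (𝓝 x₀)) (hy : ∀ᶠ a in l, y a ∈ W)
    (hO : (fun a => X.coord (x a) - X.coord (y a)) =O[l] h) : Tendsto y l (𝓝 x₀) := by
  have h1 := hO.trans_tendsto (hh.mono_right nhdsWithin_le_nhds)
  have h2 : Tendsto (fun a => X.coord (y a)) l (𝓝 (X.coord x₀)) := by
    simpa using ((P.chart.continuousAt_coord hx₀).tendsto.comp hx).sub h1
  have h3 := (P.chart.contDiffAt_g 0 (coord_mem hx₀)).continuousAt.tendsto.comp h2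
  rw [g_coord hx₀] at h3
  refine h3.congr' ?_
  filter_upwards [hy] with a ha
  exact g_coord (P.mem_image ha)

/-- The linear part of the change of coordinates is the same at all limit points. -/
theorem exists_fderiv_eq_const (P : IsPair X X' Λ Λ' H H' L L' I B B' W)
    [(𝓝[I] (0 : ℝ)).NeBot] (hS : IsConnected (W ∩ limitPoints L I)) :
    ∃ A : Matrix.SpecialLinearGroup (Fin 2) ℤ, ∀ x ∈ W ∩ limitPoints L I,
      fderiv ℝ (transition X X') (X.coord x) = intMap A.1 := by
  obtain ⟨x₀, hx₀⟩ := hS.nonempty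
  obtain ⟨A, hA⟩ := P.exists_fderiv_eq hx₀
  refine ⟨A, fun x hx => eq_intMap_of_single fun k => ?_⟩
  rw [← Matrix.mulVec_single_one, ← intMap_intPoint, ← hA]
  refine hS.isPreconnected.constant_of_mapsTo isDiscrete_range_intPoint
    (f := fun y => fderiv ℝ (transition X X') (X.coord y) (intPoint (Pi.single k 1))) ?_ ?_ hx hx₀
  · intro y hy
    have hyO := P.mem_image hy.1
    have h1 := (P.contDiffAt_transition hyO (P.symm.mem_image hy.1)).continuousAt_fderiv (by simp)
    have h2 : ContinuousAt (fun y => fderiv ℝ (transition X X') (X.coord y)) y :=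
      ContinuousAt.comp (f := X.coord) h1 (P.chart.continuousAt_coord hyO)
    exact (h2.clm_apply continuousAt_const).continuousWithinAt
  · intro y hy
    obtain ⟨A', hA'⟩ := P.exists_fderiv_eq hy
    exact ⟨A'.1.mulVec (Pi.single k 1), by simp only [hA', intMap_intPoint]⟩

/-- The change of coordinates is affine on the limit points. The model domain is convex, so the
mean value inequality applies near each limit point, including those on the boundary. -/
theorem exists_coord_eq (P : IsPair X X' Λ Λ' H H' L L' I B B' W)
    [(𝓝[I] (0 : ℝ)).NeBot] (hS : IsConnected (W ∩ limitPoints L I))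
    {A : Matrix (Fin 2) (Fin 2) ℤ} (hA : ∀ x ∈ W ∩ limitPoints L I,
      fderiv ℝ (transition X X') (X.coord x) = intMap A) :
    ∃ c : Plane, ∀ x ∈ W ∩ limitPoints L I, X'.coord x = intMap A (X.coord x) + c := by
  obtain ⟨x₀, hx₀⟩ := hS.nonempty
  refine ⟨X'.coord x₀ - intMap A (X.coord x₀), fun x hx => ?_⟩
  have hloc : IsLocallyConstant
      (fun y : (W ∩ limitPoints L I : Set Plane) => X'.coord y - intMap A (X.coord y)) := by
    rw [IsLocallyConstant.iff_eventually_eq]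
    rintro ⟨y, hy⟩
    have hyO := P.mem_image hy.1
    have hpre : X.U ∩ (X.g 0) ⁻¹' W ∈ 𝓝 (X.coord y) := by
      refine inter_mem (P.chart.isOpen.mem_nhds (coord_mem hyO))
        ((P.chart.contDiffAt_g 0 (coord_mem hyO)).continuousAt.preimage_mem_nhds ?_)
      rw [g_coord hyO]
      exact P.isOpen.mem_nhds hy.1
    obtain ⟨r, hr, hball⟩ := Metric.nhds_basis_ball.mem_iff.1 hpre
    have hK : Convex ℝ (Metric.ball (X.coord y) r ∩ H) := (convex_ball _ _).inter P.model.convex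
    have hmem : ∀ z ∈ W ∩ limitPoints L I, X.coord z ∈ H := fun z hz =>
      (P.chart.mem_limitPoints_iff P.pos P.model (P.mem_nhds hz.1)).1 hz.2
    have hder : ∀ ξ ∈ Metric.ball (X.coord y) r ∩ H,
        HasFDerivWithinAt (fun ξ => transition X X' ξ - intMap A ξ) (0 : Plane →L[ℝ] Plane)
          (Metric.ball (X.coord y) r ∩ H) ξ := by
      rintro ξ ⟨hξr, hξH⟩
      obtain ⟨hξU, hξW⟩ := hball hξr
      have hc : X.coord (X.g 0 ξ) = ξ := P.chart.coord_g hξU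
      have hlim : X.g 0 ξ ∈ W ∩ limitPoints L I := by
        refine ⟨hξW, (P.chart.mem_limitPoints_iff P.pos P.model (P.mem_nhds hξW)).2 ?_⟩
        rwa [hc]
      have h1 := ((P.contDiffAt_transition (P.mem_image hξW)
        (P.symm.mem_image hξW)).differentiableAt (by simp)).hasFDerivAt
      rw [hA _ hlim, hc] at h1
      have h2 := h1.sub (intMap A).hasFDerivAt
      rw [sub_self] at h2
      exact h2.hasFDerivWithinAt
    have hcont : ContinuousAt (fun z : (W ∩ limitPoints L I : Set Plane) => X.coord z) ⟨y, hy⟩ :=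
      ContinuousAt.comp (f := Subtype.val) (P.chart.continuousAt_coord hyO)
        continuous_subtype_val.continuousAt
    filter_upwards [hcont.preimage_mem_nhds (Metric.ball_mem_nhds _ hr)]
    rintro ⟨z, hz⟩ hzr
    have h1 := hK.norm_image_sub_le_of_norm_hasFDerivWithin_le (C := 0) hder
      (fun ξ _ => by simp) ⟨Metric.mem_ball_self hr, hmem y hy⟩ ⟨hzr, hmem z hz⟩
    rw [zero_mul, norm_le_zero_iff, sub_eq_zero] at h1
    simpa [transition, g_coord hyO, g_coord (P.mem_image hz.1)] using h1
  have : PreconnectedSpace (W ∩ limitPoints L I : Set Plane) :=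
    isPreconnected_iff_preconnectedSpace.1 hS.isPreconnected
  have h := hloc.apply_eq_of_preconnectedSpace ⟨x, hx⟩ ⟨x₀, hx₀⟩
  simp only at h
  rw [← h]
  abel

section Sequences

variable {α : Type*} {l : Filter α} {h : α → ℝ} {x y : α → Plane} {ζ ζ' : α → Fin 2 → ℤ}
  {x₀ c : Plane} {A : Matrix (Fin 2) (Fin 2) ℤ}

/-- At scale `h`, the labels of the two charts are related by an affine map, whose constant term
is known up to `o(1)`. -/
theorem tendsto_label_sub_intMap (P : IsPair X X' Λ Λ' H H' L L' I B B' W) [l.NeBot]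
    (hA : ∀ x ∈ W ∩ limitPoints L I, fderiv ℝ (transition X X') (X.coord x) = intMap A)
    (hc : ∀ x ∈ W ∩ limitPoints L I, X'.coord x = intMap A (X.coord x) + c)
    (hh : Tendsto h l (𝓝[I] 0)) (hx₀ : x₀ ∈ X.g 0 '' X.U) (hx₀' : x₀ ∈ X'.g 0 '' X'.U)
    (hx : Tendsto x l (𝓝 x₀)) (hy : ∀ᶠ a in l, y a ∈ W ∩ limitPoints L I)
    (hO : (fun a => X.coord (x a) - X.coord (y a)) =O[l] h)
    (hζ : ∀ᶠ a in l, X.Labels (h a) (ζ a) (x a))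
    (hζ' : ∀ᶠ a in l, X'.Labels (h a) (ζ' a) (x a)) :
    Tendsto (fun a => intPoint (ζ' a - A.mulVec (ζ a)) - (h a)⁻¹ • c) l
      (𝓝 (X'.shift x₀ - intMap A (X.shift x₀))) := by
  have hylim := P.tendsto_of_isBigO hh hx₀ hx (hy.mono fun a ha => ha.1) hO
  have hcx := (P.chart.continuousAt_coord hx₀).tendsto
  have hCD := P.contDiffAt_transition hx₀ hx₀'
  have hA₀ : fderiv ℝ (transition X X') (X.coord x₀) = intMap A := by
    have h1 := ((hCD.continuousAt_fderiv (by simp)).tendsto.comp hcx).comp hylim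
    refine tendsto_nhds_unique h1 (tendsto_const_nhds.congr' ?_)
    filter_upwards [hy] with a ha
    exact (hA _ ha).symm
  have hQ : HasStrictFDerivAt (fun ξ => transition X X' ξ - intMap A ξ)
      (0 : Plane →L[ℝ] Plane) (X.coord x₀) := by
    have h1 := (hCD.hasStrictFDerivAt (by simp)).sub (intMap A).hasStrictFDerivAt
    rwa [hA₀, sub_self] at h1
  have hrem := hQ.tendsto_inv_smul_sub_zero (hcx.comp hx) (hcx.comp hylim) hO
  have h1 := P.chart'.tendsto_label P.pos hh hx₀' hx hζ'
  have h2 := ((intMap A).continuous.tendsto _).comp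
    (P.chart.tendsto_label P.pos hh hx₀ hx hζ)
  have h3 := (h1.sub h2).add hrem
  rw [add_zero] at h3
  refine h3.congr' ?_
  have hxO : ∀ᶠ a in l, x a ∈ X.g 0 '' X.U := hx (P.chart.isOpen_image.mem_nhds hx₀)
  filter_upwards [hy, hxO] with a ha hxa
  have e1 : transition X X' (X.coord (x a)) = X'.coord (x a) := by
    rw [transition, g_coord hxa]
  have e2 : transition X X' (X.coord (y a)) = intMap A (X.coord (y a)) + c := by
    rw [transition, g_coord (P.mem_image ha.1), hc _ ha]
  simp only [Function.comp_apply, e1, e2, map_sub, map_smul, intPoint_sub, intMap_intPoint,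
    smul_sub, smul_add]
  abel

/-- A point labelled by an element of `Λ` and close to a point of `W` is, up to `O(h)`, a limit
point. -/
theorem exists_near (P : IsPair X X' Λ Λ' H H' L L' I B B' W) [(𝓝[I] (0 : ℝ)).NeBot]
    (hh : Tendsto h l (𝓝[I] 0)) (hx₀ : x₀ ∈ W) (hx : Tendsto x l (𝓝 x₀))
    (hζ : ∀ᶠ a in l, X.Labels (h a) (ζ a) (x a)) (hH : ∀ᶠ a in l, scaledPoint (h a) (ζ a) ∈ H) :
    ∃ y : α → Plane, (∀ᶠ a in l, y a ∈ W ∩ limitPoints L I) ∧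
      (fun a => X.coord (x a) - X.coord (y a)) =O[l] h := by
  have hx₀O := P.mem_image hx₀
  refine ⟨fun a => X.g 0 (scaledPoint (h a) (ζ a)), ?_, ?_⟩
  · have h1 : Tendsto (fun a => X.g 0 (scaledPoint (h a) (ζ a))) l (𝓝 x₀) := by
      simpa using hx.sub (P.chart.tendsto_sub_zero P.pos hh hζ)
    filter_upwards [h1 (P.isOpen.mem_nhds hx₀), hζ, hH] with a hW ha hHa
    refine ⟨hW, (P.chart.mem_limitPoints_iff P.pos P.model (P.mem_nhds hW)).2 ?_⟩
    rwa [P.chart.coord_g ha.1]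
  · refine (P.chart.isBigO_coord_sub P.pos hh hx₀O hx hζ).congr' ?_ EventuallyEq.rfl
    filter_upwards [hζ] with a ha
    rw [P.chart.coord_g ha.1]

end Sequences

end IsPair

end ChartData

namespace ChartData

namespace IsPair

variable {X X' : ChartData} {Λ Λ' : Set (Fin 2 → ℤ)} {H H' : Set Plane}
    {L L' : ℝ → Set Plane} {I : Set ℝ} {B B' W : Set Plane}

/-- The conclusion of `tendsto_label_sub_intMap` at a limit point in `W`, for the labels of some
family of points that converges to it. -/
theorem exists_tendsto_label_sub (P : IsPair X X' Λ Λ' H H' L L' I B B' W)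
    [(𝓝[I] (0 : ℝ)).NeBot] {A : Matrix (Fin 2) (Fin 2) ℤ} {c : Plane}
    (hA : ∀ x ∈ W ∩ limitPoints L I, fderiv ℝ (transition X X') (X.coord x) = intMap A)
    (hc : ∀ x ∈ W ∩ limitPoints L I, X'.coord x = intMap A (X.coord x) + c)
    {x : Plane} (hx : x ∈ W ∩ limitPoints L I) :
    ∃ κ : ℝ → Fin 2 → ℤ, Tendsto (fun h => intPoint (κ h) - h⁻¹ • c) (𝓝[I] 0)
      (𝓝 (X'.shift x - intMap A (X.shift x))) := by
  have hxH := (P.chart.mem_limitPoints_iff P.pos P.model (P.mem_nhds hx.1)).1 hx.2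
  obtain ⟨y, hy, hyl⟩ := P.chart.exists_labelled P.pos P.model (P.mem_nhds hx.1) hxH
    (v := 0) le_rfl
  have hex : ∀ᶠ h in 𝓝[I] 0, ∃ ζ', X'.Labels h ζ' (y h) := by
    filter_upwards [hy (P.isOpen.mem_nhds hx.1), hyl, self_mem_nhdsWithin] with h hW hL hI
    have hm : y h ∈ L' h ∩ W := by
      rw [← P.agree h hI]
      exact ⟨hL.1, hW⟩
    obtain ⟨ζ, -, hζ⟩ := P.chart'.exists_index h hI (y h) hm.1
    exact ⟨ζ, hζ⟩
  obtain ⟨ζ', hζ'⟩ := hex.choice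
  have hH : ∀ᶠ h in 𝓝[I] 0, scaledPoint h ((fun i => ⌊X.coord x i / h⌋) + 0) ∈ H := by
    filter_upwards [self_mem_nhdsWithin] with h hI
    exact P.model.scaledPoint_mem h (P.pos hI) _
      (P.model.floor_add_mem h (P.pos hI) _ hxH 0 le_rfl)
  obtain ⟨z, hz, hO⟩ := P.exists_near tendsto_id hx.1 hy (hyl.mono fun h hh => hh.2) hH
  exact ⟨_, P.tendsto_label_sub_intMap hA hc tendsto_id (P.mem_image hx.1)
    (P.symm.mem_image hx.1) hy hz hO (hyl.mono fun h hh => hh.2) hζ'⟩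

/-- The first order terms of the two charts differ by a constant: their difference varies
continuously, and by integral amounts. -/
theorem shift_sub_eq (P : IsPair X X' Λ Λ' H H' L L' I B B' W)
    [(𝓝[I] (0 : ℝ)).NeBot] (hS : IsConnected (W ∩ limitPoints L I))
    {A : Matrix (Fin 2) (Fin 2) ℤ} {c : Plane}
    (hA : ∀ x ∈ W ∩ limitPoints L I, fderiv ℝ (transition X X') (X.coord x) = intMap A)
    (hc : ∀ x ∈ W ∩ limitPoints L I, X'.coord x = intMap A (X.coord x) + c)
    {x x₀ : Plane} (hx : x ∈ W ∩ limitPoints L I) (hx₀ : x₀ ∈ W ∩ limitPoints L I) :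
    X'.shift x - intMap A (X.shift x) = X'.shift x₀ - intMap A (X.shift x₀) := by
  set D : Plane → Plane := fun y => X'.shift y - intMap A (X.shift y)
  obtain ⟨κ₀, hκ₀⟩ := P.exists_tendsto_label_sub hA hc hx₀
  have h : D x - D x₀ = D x₀ - D x₀ := by
    refine hS.isPreconnected.constant_of_mapsTo isDiscrete_range_intPoint
      (f := fun y => D y - D x₀) ?_ ?_ hx hx₀
    · intro y hy
      have h1 := P.chart.continuousAt_shift (P.mem_image hy.1)
      have h2 := P.chart'.continuousAt_shift (P.symm.mem_image hy.1)
      exact ((h2.sub ((intMap A).continuous.continuousAt.comp h1)).sub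
        continuousAt_const).continuousWithinAt
    · intro y hy
      obtain ⟨κ, hκ⟩ := P.exists_tendsto_label_sub hA hc hy
      have h1 : Tendsto (fun h => intPoint (κ h - κ₀ h)) (𝓝[I] 0) (𝓝 (D y - D x₀)) := by
        refine (hκ.sub hκ₀).congr fun h => ?_
        rw [intPoint_sub]
        abel
      obtain ⟨η, hη, -⟩ := exists_eventually_eq_of_tendsto_intPoint h1
      exact ⟨η, hη.symm⟩
  exact sub_left_injective h

/-- **Rigidity of labels.** The labels of the two charts are related, for small `h`, by an affine
map of `ℤ²` with fixed linear part in `SL(2, ℤ)`. This holds on every set whose points are at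
distance `O(h)` from the limit points in `W`, and in particular up to the boundary of `W`. -/
theorem exists_affine (P : IsPair X X' Λ Λ' H H' L L' I B B' W)
    [(𝓝[I] (0 : ℝ)).NeBot] (hS : IsConnected (W ∩ limitPoints L I)) :
    ∃ (A : Matrix.SpecialLinearGroup (Fin 2) ℤ) (κ : ℝ → Fin 2 → ℤ) (c : Plane),
      (fun h : ℝ => h • intPoint (κ h) - c) =O[𝓝[I] 0] (fun h => h) ∧
      ∀ V : Set Plane, Bornology.IsBounded V → closure V ⊆ X.g 0 '' X.U →
        closure V ⊆ X'.g 0 '' X'.U → IsNear X L I (W ∩ limitPoints L I) V →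
        ∀ᶠ h in 𝓝[I] 0, ∀ x ∈ L h ∩ V, ∀ ζ ζ', X.Labels h ζ x → X'.Labels h ζ' x →
          ζ' = A.1.mulVec ζ + κ h := by
  obtain ⟨A, hA⟩ := P.exists_fderiv_eq_const hS
  obtain ⟨c, hc⟩ := P.exists_coord_eq hS hA
  obtain ⟨x₀, hx₀⟩ := hS.nonempty
  obtain ⟨κ, hκ⟩ := P.exists_tendsto_label_sub hA hc hx₀
  refine ⟨A, κ, c, ?_, ?_⟩
  · have h1 := (Asymptotics.isBigO_refl (fun h : ℝ => h) (𝓝[I] 0)).smul (hκ.isBigO_one ℝ)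
    refine h1.congr' ?_ (Eventually.of_forall fun h => by simp)
    filter_upwards [self_mem_nhdsWithin] with h hh
    have : (h : ℝ) ≠ 0 := (P.pos hh).ne'
    rw [smul_sub, smul_smul, mul_inv_cancel₀ this, one_smul]
  · rintro V hVb hVO hVO' ⟨C, hC⟩
    -- otherwise, an ultrafilter of bad parameters produces a convergent family of bad points
    by_contra hcon
    have hne : (𝓝[I] (0 : ℝ) ⊓ 𝓟 {h | ¬ ∀ x ∈ L h ∩ V, ∀ ζ ζ', X.Labels h ζ x →
        X'.Labels h ζ' x → ζ' = A.1.mulVec ζ + κ h}).NeBot :=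
      Filter.frequently_mem_iff_neBot.1 (Filter.not_eventually.1 hcon)
    set u : Ultrafilter ℝ := Ultrafilter.of (𝓝[I] (0 : ℝ) ⊓ 𝓟 {h | ¬ ∀ x ∈ L h ∩ V, ∀ ζ ζ',
      X.Labels h ζ x → X'.Labels h ζ' x → ζ' = A.1.mulVec ζ + κ h})
    have hu := Ultrafilter.of_le (𝓝[I] (0 : ℝ) ⊓ 𝓟 {h | ¬ ∀ x ∈ L h ∩ V, ∀ ζ ζ',
      X.Labels h ζ x → X'.Labels h ζ' x → ζ' = A.1.mulVec ζ + κ h})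
    have hu0 : (u : Filter ℝ) ≤ 𝓝[I] 0 := hu.trans inf_le_left
    have hbad : ∀ᶠ h in (u : Filter ℝ), ∃ p : Plane × (Fin 2 → ℤ) × (Fin 2 → ℤ) × Plane,
        p.1 ∈ L h ∩ V ∧ X.Labels h p.2.1 p.1 ∧ X'.Labels h p.2.2.1 p.1 ∧
        p.2.2.1 ≠ A.1.mulVec p.2.1 + κ h ∧ p.2.2.2 ∈ W ∩ limitPoints L I ∧
        ‖X.coord p.1 - X.coord p.2.2.2‖ ≤ C * h := by
      filter_upwards [hu0 hC, (hu.trans inf_le_right) (mem_principal_self _)] with h h1 h2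
      simp only [not_forall] at h2
      obtain ⟨x, hx, ζ, ζ', h3, h4, h5⟩ := h2
      obtain ⟨y, hy, hxy⟩ := h1 x hx
      exact ⟨(x, ζ, ζ', y), hx, h3, h4, h5, hy, hxy⟩
    obtain ⟨p, hp⟩ := hbad.choice
    obtain ⟨z, hz, hlim⟩ : ∃ z ∈ closure V, Tendsto (fun h => (p h).1) u (𝓝 z) := by
      have hle : ((u.map fun h => (p h).1 : Ultrafilter Plane) : Filter Plane)
          ≤ 𝓟 (closure V) := by
        rw [le_principal_iff]
        exact hp.mono fun h hh => subset_closure hh.1.2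
      exact hVb.isCompact_closure.ultrafilter_le_nhds _ hle
    have hO : (fun h => X.coord (p h).1 - X.coord (p h).2.2.2) =O[u] fun h => h := by
      refine Asymptotics.IsBigO.of_bound |C| ?_
      filter_upwards [hp] with h hh
      refine hh.2.2.2.2.2.trans ((le_abs_self _).trans ?_)
      rw [abs_mul, Real.norm_eq_abs]
    have hy := hp.mono fun h hh => hh.2.2.2.2.1
    have hylim := P.tendsto_of_isBigO hu0 (hVO hz) hlim (hy.mono fun h hh => hh.1) hO
    have hD : X'.shift z - intMap A (X.shift z) = X'.shift x₀ - intMap A (X.shift x₀) := by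
      have h1 := ((P.chart'.continuousAt_shift (hVO' hz)).tendsto.comp hylim).sub
        (((intMap A).continuous.tendsto _).comp
          ((P.chart.continuousAt_shift (hVO hz)).tendsto.comp hylim))
      refine tendsto_nhds_unique h1 (tendsto_const_nhds.congr' ?_)
      filter_upwards [hy] with h hh
      exact (P.shift_sub_eq hS hA hc hh hx₀).symm
    have h1 := P.tendsto_label_sub_intMap hA hc hu0 (hVO hz) (hVO' hz) hlim hy hO
      (hp.mono fun h hh => hh.2.1) (hp.mono fun h hh => hh.2.2.1)
    rw [hD] at h1
    have h2 : Tendsto (fun h => intPoint ((p h).2.2.1 - A.1.mulVec (p h).2.1 - κ h)) u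
        (𝓝 (intPoint 0)) := by
      have e : intPoint 0 = 0 := by ext i; simp
      have h3 := h1.sub (hκ.mono_left hu0)
      rw [sub_self] at h3
      rw [e]
      refine h3.congr fun h => ?_
      rw [intPoint_sub ((p h).2.2.1 - A.1.mulVec (p h).2.1)]
      abel
    obtain ⟨η, hη, hev⟩ := exists_eventually_eq_of_tendsto_intPoint h2
    have hη0 : η = 0 := isClosedEmbedding_intPoint.injective hη.symm
    obtain ⟨h, hh, hh'⟩ := (hev.and hp).exists
    apply hh'.2.2.2.1
    rw [hη0, sub_sub, sub_eq_zero] at hh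
    exact hh

end IsPair

end ChartData

/-! ### Points near the limit points, and uniqueness of affine maps -/

namespace ChartData

namespace IsChart

variable {X : ChartData} {Λ : Set (Fin 2 → ℤ)} {H : Set Plane} {L : ℝ → Set Plane} {I : Set ℝ}
  {B : Set Plane}

/-- The coordinate of a labelled point is at distance `O(h)` from its scaled label, uniformly on
compact sets. -/
theorem exists_norm_coord_sub_le (hX : X.IsChart Λ L I B) (hI : I ⊆ Ioi 0) {K : Set Plane}
    (hK : IsCompact K) (hKO : K ⊆ X.g 0 '' X.U) :
    ∃ C : ℝ, ∀ᶠ h in 𝓝[I] (0 : ℝ), ∀ x ∈ K, ∀ ζ, X.Labels h ζ x →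
      ‖X.coord x - scaledPoint h ζ‖ ≤ C * h := by
  refine hK.induction_on (p := fun K => ∃ C : ℝ, ∀ᶠ h in 𝓝[I] (0 : ℝ), ∀ x ∈ K, ∀ ζ,
    X.Labels h ζ x → ‖X.coord x - scaledPoint h ζ‖ ≤ C * h) ⟨0, by simp⟩ ?_ ?_ ?_
  · rintro s t hst ⟨C, hC⟩
    exact ⟨C, hC.mono fun h hh x hx => hh x (hst hx)⟩
  · rintro s t ⟨C, hC⟩ ⟨C', hC'⟩
    refine ⟨max C C', ?_⟩
    filter_upwards [hC, hC', self_mem_nhdsWithin] with h h1 h2 hhI x hx ζ hζ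
    have hpos : 0 ≤ h := (hI hhI : 0 < h).le
    rcases hx with hx | hx
    · exact (h1 x hx ζ hζ).trans (mul_le_mul_of_nonneg_right (le_max_left _ _) hpos)
    · exact (h2 x hx ζ hζ).trans (mul_le_mul_of_nonneg_right (le_max_right _ _) hpos)
  · intro x hx
    obtain ⟨k, s, hs, hlip⟩ := ((hX.contDiffAt_coord (hKO hx)).of_le
      (m := 1) (by exact_mod_cast le_top)).exists_lipschitzOnWith
    obtain ⟨r, hr, hball⟩ := Metric.nhds_basis_ball.mem_iff.1 hs
    obtain ⟨M, hMpos, hM⟩ := hX.exists_norm_sub_le hI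
    refine ⟨Metric.ball x (r / 2), mem_nhdsWithin_of_mem_nhds
      (Metric.ball_mem_nhds x (half_pos hr)), k * M, ?_⟩
    have hsmall : ∀ᶠ h in 𝓝[I] (0 : ℝ), M * h < r / 2 := by
      have : Tendsto (fun h : ℝ => M * h) (𝓝[I] 0) (𝓝 (M * 0)) :=
        (tendsto_id.mono_left nhdsWithin_le_nhds).const_mul M
      rw [mul_zero] at this
      exact this (Iio_mem_nhds (half_pos hr))
    filter_upwards [hM, hsmall] with h h1 h2 y hy ζ hζ
    have h3 := h1 y ζ hζ
    have hy1 : y ∈ Metric.ball x r := Metric.ball_subset_ball (by linarith) hy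
    have hy2 : X.g 0 (scaledPoint h ζ) ∈ Metric.ball x r := by
      rw [Metric.mem_ball] at hy ⊢
      have h4 := dist_triangle_left (X.g 0 (scaledPoint h ζ)) x y
      rw [dist_eq_norm y (X.g 0 _)] at h4
      linarith
    have h5 := hlip.norm_sub_le (hball hy1) (hball hy2)
    rw [hX.coord_g hζ.1] at h5
    refine h5.trans ?_
    rw [mul_assoc]
    exact mul_le_mul_of_nonneg_left h3 k.2

theorem isNear_of_closure_subset (hX : X.IsChart Λ L I B) (hI : I ⊆ Ioi 0)
    [(𝓝[I] (0 : ℝ)).NeBot] (hΛ : IsIndexModel Λ H) {V W : Set Plane} (hW : IsOpen W) (hWB : W ⊆ B)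
    (hV : Bornology.IsBounded V) (hVW : closure V ⊆ W) :
    IsNear X L I (W ∩ limitPoints L I) V := by
  obtain ⟨C, hC⟩ := hX.exists_norm_coord_sub_le hI hV.isCompact_closure
    (hVW.trans (hWB.trans hX.subset_image))
  obtain ⟨M, hMpos, hM⟩ := hX.exists_norm_sub_le hI
  obtain ⟨δ, hδ, hthick⟩ := hV.isCompact_closure.exists_thickening_subset_open hW hVW
  refine ⟨C, ?_⟩
  have hsmall : ∀ᶠ h in 𝓝[I] (0 : ℝ), M * h < δ := by
    have : Tendsto (fun h : ℝ => M * h) (𝓝[I] 0) (𝓝 (M * 0)) :=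
      (tendsto_id.mono_left nhdsWithin_le_nhds).const_mul M
    rw [mul_zero] at this
    exact this (Iio_mem_nhds hδ)
  filter_upwards [hC, hM, hsmall, self_mem_nhdsWithin] with h h1 h2 h3 hhI x hx
  obtain ⟨ζ, hζΛ, hζ⟩ := hX.exists_index h hhI x hx.1
  have hW' : X.g 0 (scaledPoint h ζ) ∈ W := by
    refine hthick (Metric.mem_thickening_iff.2 ⟨x, subset_closure hx.2, ?_⟩)
    rw [dist_comm, dist_eq_norm]
    exact (h2 x ζ hζ).trans_lt h3
  refine ⟨X.g 0 (scaledPoint h ζ), ⟨hW', (hX.mem_limitPoints_iff hI hΛ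
    (mem_of_superset (hW.mem_nhds hW') hWB)).2 ?_⟩, ?_⟩
  · rw [hX.coord_g hζ.1]
    exact hΛ.scaledPoint_mem h (hI hhI) ζ hζΛ
  · rw [hX.coord_g hζ.1]
    exact h1 x (subset_closure hx.2) ζ hζ

/-- A set whose coordinate image is convex and meets the horizontal axis is near its own limit
points, up to its boundary: a point at depth `O(h)` below the axis is pushed back to the upper
half-plane along the segment to a fixed interior point. -/
theorem isNear_of_convex (hX : X.IsChart upperIndices L I B) (hI : I ⊆ Ioi 0)
    [(𝓝[I] (0 : ℝ)).NeBot] (hB : Bornology.IsBounded B)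
    {V : Set Plane} (hV : IsOpen V) (hVB : V ⊆ B) (hconv : Convex ℝ (X.principalPreimage V))
    (hne : ∃ ξ ∈ X.principalPreimage V, ξ 1 = 0) :
    IsNear X L I (V ∩ limitPoints L I) V := by
  obtain ⟨ξ₀, hξ₀, hξ₀0⟩ := hne
  have hopen : X.principalPreimage V ∈ 𝓝 ξ₀ := inter_mem (hX.isOpen.mem_nhds hξ₀.1)
    ((hX.contDiffAt_g 0 hξ₀.1).continuousAt.preimage_mem_nhds (hV.mem_nhds hξ₀.2))
  obtain ⟨p₀, hp₀, hp₀pos⟩ : ∃ p₀ ∈ X.principalPreimage V, 0 < p₀ 1 := by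
    have hlim : Tendsto (fun t : ℝ => ξ₀ + t • intPoint (Pi.single 1 1)) (𝓝[>] 0) (𝓝 ξ₀) := by
      have : Tendsto (fun t : ℝ => ξ₀ + t • intPoint (Pi.single 1 1)) (𝓝 0)
          (𝓝 (ξ₀ + (0 : ℝ) • intPoint (Pi.single 1 1))) := by
        apply Continuous.tendsto
        fun_prop
      rw [zero_smul, add_zero] at this
      exact this.mono_left nhdsWithin_le_nhds
    obtain ⟨t, ht, htpos⟩ := ((hlim.eventually hopen).and self_mem_nhdsWithin).exists
    refine ⟨_, ht, ?_⟩
    have : (0 : ℝ) < t := htpos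
    simpa [hξ₀0] using this
  obtain ⟨C, hC⟩ := hX.exists_norm_coord_sub_le hI hB.isCompact_closure hX.closure_subset
  obtain ⟨R, hR⟩ := hX.isBounded.subset_closedBall p₀
  refine ⟨|C| / p₀ 1 * R, ?_⟩
  filter_upwards [hC, self_mem_nhdsWithin] with h h1 hhI x hx
  have hpos : 0 < h := hI hhI
  have hxO : x ∈ X.g 0 '' X.U := hX.subset_image (hVB hx.2)
  obtain ⟨ζ, hζΛ, hζ⟩ := hX.exists_index h hhI x hx.1
  have hdist := h1 x (subset_closure (hVB hx.2)) ζ hζ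
  set p := X.coord x
  have hpK : p ∈ X.principalPreimage V := ⟨coord_mem hxO, by rw [g_coord hxO]; exact hx.2⟩
  have hz : 0 ≤ (scaledPoint h ζ) 1 := isIndexModel_upper.scaledPoint_mem h hpos ζ hζΛ
  have hp1 : -(|C| * h) ≤ p 1 := by
    have h2 : |p 1 - (scaledPoint h ζ) 1| ≤ ‖p - scaledPoint h ζ‖ := by
      simpa using PiLp.norm_apply_le (p - scaledPoint h ζ) 1
    have h3 : C * h ≤ |C| * h := mul_le_mul_of_nonneg_right (le_abs_self C) hpos.le
    have h4 := (abs_le.1 (h2.trans hdist)).1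
    linarith
  set e : ℝ := |C| * h
  have he : 0 ≤ e := by positivity
  have hden : 0 < p₀ 1 + e := by positivity
  set t : ℝ := e / (p₀ 1 + e)
  have ht0 : 0 ≤ t := by positivity
  have ht1 : t ≤ 1 := by
    rw [div_le_one hden]
    linarith
  set η : Plane := (1 - t) • p + t • p₀
  have hηK : η ∈ X.principalPreimage V := hconv hpK hp₀ (by linarith) ht0 (by ring)
  have hη1 : 0 ≤ η 1 := by
    have h2 : η 1 = (1 - t) * p 1 + t * p₀ 1 := by simp [η]
    have h3 : (1 - t) * (-e) + t * p₀ 1 = 0 := by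
      have : t * (p₀ 1 + e) = e := div_mul_cancel₀ e hden.ne'
      linarith
    have h4 : (1 - t) * (-e) ≤ (1 - t) * p 1 := mul_le_mul_of_nonneg_left hp1 (by linarith)
    linarith
  have hcη : X.coord (X.g 0 η) = η := hX.coord_g hηK.1
  refine ⟨X.g 0 η, ⟨hηK.2, (hX.mem_limitPoints_iff hI isIndexModel_upper
    (mem_of_superset (hV.mem_nhds hηK.2) hVB)).2 ?_⟩, ?_⟩
  · rw [hcη]
    exact hη1
  · rw [hcη]
    have h2 : p - η = t • (p - p₀) := by
      simp only [η]
      module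
    have h3 : ‖p - p₀‖ ≤ R := by
      rw [← dist_eq_norm]
      exact hR (coord_mem hxO)
    have h4 : t ≤ |C| / p₀ 1 * h := by
      rw [div_mul_eq_mul_div]
      exact div_le_div_of_nonneg_left he hp₀pos (by linarith)
    rw [h2, norm_smul, Real.norm_of_nonneg ht0]
    calc t * ‖p - p₀‖ ≤ (|C| / p₀ 1 * h) * R :=
          mul_le_mul h4 h3 (norm_nonneg _) (by positivity)
      _ = |C| / p₀ 1 * R * h := by ring

/-- An affine map of `ℤ²` is determined, for small `h`, by its values on the labels of the points
close to one limit point. -/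
theorem affine_unique (hX : X.IsChart Λ L I B) (hI : I ⊆ Ioi 0) [(𝓝[I] (0 : ℝ)).NeBot]
    (hΛ : IsIndexModel Λ H) {x : Plane} {N : Set Plane} (hN : N ∈ 𝓝 x) (hB : B ∈ 𝓝 x)
    (hx : x ∈ limitPoints L I) {A A' : Matrix (Fin 2) (Fin 2) ℤ} {κ κ' : ℝ → Fin 2 → ℤ}
    (h : ∀ᶠ h in 𝓝[I] (0 : ℝ), ∀ y ∈ L h ∩ N, ∀ ζ, X.Labels h ζ y →
      A.mulVec ζ + κ h = A'.mulVec ζ + κ' h) : A = A' ∧ ∀ᶠ h in 𝓝[I] (0 : ℝ), κ h = κ' h := by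
  have hxH := (hX.mem_limitPoints_iff hI hΛ hB).1 hx
  have key : ∀ v : Fin 2 → ℤ, 0 ≤ v → ∀ᶠ h in 𝓝[I] (0 : ℝ),
      A.mulVec ((fun i => ⌊X.coord x i / h⌋) + v) + κ h
        = A'.mulVec ((fun i => ⌊X.coord x i / h⌋) + v) + κ' h := by
    intro v hv
    obtain ⟨y, hy, hyl⟩ := hX.exists_labelled hI hΛ hB hxH hv
    filter_upwards [h, hy hN, hyl] with h h1 h2 h3
    exact h1 (y h) ⟨h3.1, h2⟩ _ h3.2
  have hA : A = A' := by
    ext i k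
    obtain ⟨h, h1, h2⟩ := ((key 0 le_rfl).and (key (Pi.single k 1) (by simp))).exists
    rw [add_zero] at h1
    rw [Matrix.mulVec_add, Matrix.mulVec_add, add_right_comm, h1, add_right_comm,
      Matrix.mulVec_single_one, Matrix.mulVec_single_one] at h2
    exact congrFun (add_left_cancel (add_right_cancel h2)) i
  refine ⟨hA, (key 0 le_rfl).mono fun h hh => ?_⟩
  rw [hA] at hh
  exact add_left_cancel hh

end IsChart

end ChartData

/-! ### Gluing the labels of finitely many charts -/

/-- Charts `X i` of families `L i` in open sets `B i`, with smaller open sets `B' i`, and the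
topological properties of these sets that the gluing of labels depends on. Lattices and
half-lattices are treated alike. -/
structure IsAtlas (I : Set ℝ) {q : ℕ} (B B' : Fin q → Set Plane) (L : Fin q → ℝ → Set Plane)
    (X : Fin q → ChartData) (Λ : Fin q → Set (Fin 2 → ℤ)) (H : Fin q → Set Plane) : Prop where
  pos : I ⊆ Ioi 0
  neBot : (𝓝[I] (0 : ℝ)).NeBot
  chart : ∀ i, (X i).IsChart (Λ i) (L i) I (B i)
  model : ∀ i, IsIndexModel (Λ i) (H i)
  isOpen : ∀ i, IsOpen (B i)
  isBounded : ∀ i, Bornology.IsBounded (B i)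
  nonempty : ∀ i, (B i).Nonempty
  preconnected : ∀ i, IsPreconnected (B i)
  union_simplyConnected : IsSimplyConnected (⋃ i, B i)
  family_subset : ∀ i, ∀ h ∈ I, L i h ⊆ B i
  agree : ∀ i j, (B i ∩ B j).Nonempty → ∀ h ∈ I, L i h ∩ B j = L j h ∩ B i
  connected_inter : ∀ i j, (B i ∩ B j).Nonempty → IsConnected (B i ∩ B j ∩ limitPoints (L i) I)
  triple : ∀ i j k, (B i ∩ B j ∩ B k).Nonempty →
    (B i ∩ B j ∩ B k ∩ limitPoints (L i) I).Nonempty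
  isOpen' : ∀ i, IsOpen (B' i)
  nonempty' : ∀ i, (B' i).Nonempty
  union_preconnected' : IsPreconnected (⋃ i, B' i)
  closure_subset : ∀ i, closure (B' i) ⊆ B i
  connected' : ∀ i, IsConnected (B' i ∩ limitPoints (L i) I)
  near' : ∀ i, (X i).IsNear (L i) I (B' i ∩ limitPoints (L i) I) (B' i)
  overlap' : ∀ i j, (B' i ∩ B' j).Nonempty → (B' i ∩ B' j ∩ limitPoints (L i) I).Nonempty

namespace IsAtlas

variable {I : Set ℝ} {q : ℕ} {B B' : Fin q → Set Plane} {L : Fin q → ℝ → Set Plane}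
  {X : Fin q → ChartData} {Λ : Fin q → Set (Fin 2 → ℤ)} {H : Fin q → Set Plane}

theorem isPair (T : IsAtlas I B B' L X Λ H) {i j : Fin q} (hij : (B i ∩ B j).Nonempty) :
    (X i).IsPair (X j) (Λ i) (Λ j) (H i) (H j) (L i) (L j) I (B i) (B j) (B i ∩ B j) where
  pos := T.pos
  chart := T.chart i
  chart' := T.chart j
  model := T.model i
  model' := T.model j
  isOpen := (T.isOpen i).inter (T.isOpen j)
  subset := inter_subset_left
  subset' := inter_subset_right
  agree h hh := by
    rw [← inter_assoc, inter_eq_left.2 (T.family_subset i h hh), T.agree i j hij h hh,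
      inter_comm (B i), ← inter_assoc, inter_eq_left.2 (T.family_subset j h hh)]

theorem mem_of_mem_inter (T : IsAtlas I B B' L X Λ H) {i j : Fin q} {h : ℝ} (hh : h ∈ I)
    {x : Plane} (hx : x ∈ L i h) (hj : x ∈ B j) : x ∈ L j h := by
  have hi := T.family_subset i h hh hx
  have : x ∈ L j h ∩ B i := by
    rw [← T.agree i j ⟨x, hi, hj⟩ h hh]
    exact ⟨hx, hj⟩
  exact this.1

/-- The transition maps between the labels of the charts of an atlas form a cocycle of affine maps
of `ℤ²`, defined for small `h`. -/
theorem exists_transition (T : IsAtlas I B B' L X Λ H) :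
    ∃ (A : Fin q → Fin q → Matrix.SpecialLinearGroup (Fin 2) ℤ)
      (κ : Fin q → Fin q → ℝ → Fin 2 → ℤ) (c : Fin q → Fin q → Plane),
      (∀ i j, (B i ∩ B j).Nonempty →
        (fun h : ℝ => h • intPoint (κ i j h) - c i j) =O[𝓝[I] 0] (fun h => h)) ∧
      (∀ i j V, Bornology.IsBounded V → closure V ⊆ B i ∩ B j →
        ∀ᶠ h in 𝓝[I] 0, ∀ x ∈ L i h ∩ V, ∀ ζ ζ', (X i).Labels h ζ x → (X j).Labels h ζ' x →
          ζ' = (A i j).1.mulVec ζ + κ i j h) ∧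
      ∀ i j k, (B i ∩ B j ∩ B k).Nonempty → A j k * A i j = A i k ∧
        ∀ᶠ h in 𝓝[I] (0 : ℝ), (A j k).1.mulVec (κ i j h) + κ j k h = κ i k h := by
  have := T.neBot
  have hex : ∀ i j, ∃ (A : Matrix.SpecialLinearGroup (Fin 2) ℤ) (κ : ℝ → Fin 2 → ℤ) (c : Plane),
      (B i ∩ B j).Nonempty →
      ((fun h : ℝ => h • intPoint (κ h) - c) =O[𝓝[I] 0] (fun h => h)) ∧
      ∀ V, Bornology.IsBounded V → closure V ⊆ B i ∩ B j →
        ∀ᶠ h in 𝓝[I] 0, ∀ x ∈ L i h ∩ V, ∀ ζ ζ', (X i).Labels h ζ x → (X j).Labels h ζ' x →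
          ζ' = A.1.mulVec ζ + κ h := by
    intro i j
    by_cases hij : (B i ∩ B j).Nonempty
    · obtain ⟨A, κ, c, hO, h⟩ := (T.isPair hij).exists_affine (T.connected_inter i j hij)
      refine ⟨A, κ, c, fun _ => ⟨hO, fun V hVb hV => h V hVb ?_ ?_ ?_⟩⟩
      · exact hV.trans (inter_subset_left.trans (T.chart i).subset_image)
      · exact hV.trans (inter_subset_right.trans (T.chart j).subset_image)
      · exact (T.chart i).isNear_of_closure_subset T.pos (T.model i) (T.isPair hij).isOpen
          inter_subset_left hVb hV
    · exact ⟨1, 0, 0, fun h => absurd h hij⟩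
  choose A κ c hAκ using hex
  refine ⟨A, κ, c, fun i j hij => (hAκ i j hij).1, fun i j V hVb hV => ?_, fun i j k hijk => ?_⟩
  · by_cases hij : (B i ∩ B j).Nonempty
    · exact (hAκ i j hij).2 V hVb hV
    · have hV0 : V = ∅ := by
        rw [not_nonempty_iff_eq_empty] at hij
        rw [hij] at hV
        exact subset_empty_iff.1 (subset_closure.trans hV)
      simp [hV0]
  · obtain ⟨x, ⟨⟨hxi, hxj⟩, hxk⟩, hx⟩ := T.triple i j k hijk
    have hopen : IsOpen (B i ∩ B j ∩ B k) :=
      ((T.isOpen i).inter (T.isOpen j)).inter (T.isOpen k)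
    obtain ⟨r, hr, hball⟩ := Metric.nhds_basis_closedBall.mem_iff.1
      (hopen.mem_nhds ⟨⟨hxi, hxj⟩, hxk⟩)
    set V := Metric.closedBall x r
    have hVb : Bornology.IsBounded V := Metric.isBounded_closedBall
    have hVc : closure V = V := Metric.isClosed_closedBall.closure_eq
    have h1 := (hAκ i j ⟨x, hxi, hxj⟩).2 V hVb (by rw [hVc]; exact fun y hy => (hball hy).1)
    have h2 := (hAκ j k ⟨x, hxj, hxk⟩).2 V hVb
      (by rw [hVc]; exact fun y hy => ⟨(hball hy).1.2, (hball hy).2⟩)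
    have h3 := (hAκ i k ⟨x, hxi, hxk⟩).2 V hVb
      (by rw [hVc]; exact fun y hy => ⟨(hball hy).1.1, (hball hy).2⟩)
    have hu := (T.chart i).affine_unique T.pos (T.model i) (Metric.closedBall_mem_nhds x hr)
      ((T.isOpen i).mem_nhds hxi) hx (A := (A j k).1 * (A i j).1) (A' := (A i k).1)
      (κ := fun h => (A j k).1.mulVec (κ i j h) + κ j k h) (κ' := κ i k) ?_
    · exact ⟨Subtype.ext hu.1, hu.2⟩
    · filter_upwards [h1, h2, h3, self_mem_nhdsWithin] with h e1 e2 e3 hhI y hy ζ hζ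
      have hyj : y ∈ L j h := T.mem_of_mem_inter hhI hy.1 (hball hy.2).1.2
      have hyk : y ∈ L k h := T.mem_of_mem_inter hhI hy.1 (hball hy.2).2
      obtain ⟨ζj, -, hζj⟩ := (T.chart j).exists_index h hhI y hyj
      obtain ⟨ζk, -, hζk⟩ := (T.chart k).exists_index h hhI y hyk
      rw [← e3 y hy ζ ζk hζ hζk, e2 y ⟨hyj, hy.2⟩ ζj ζk hζj hζk, e1 y hy ζ ζj hζ hζj,
        Matrix.mulVec_add, Matrix.mulVec_mulVec, add_assoc]

/-- Since the union of the sets `B i` is simply connected, the cocycle of transition maps is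
trivial: after composition with affine maps of `ℤ²`, the labels of the charts match. -/
theorem exists_gluing (T : IsAtlas I B B' L X Λ H) :
    ∃ (A : Fin q → Matrix.SpecialLinearGroup (Fin 2) ℤ) (b : Fin q → ℝ → Fin 2 → ℤ)
      (r : Fin q → Plane),
      (∀ i, (fun h : ℝ => h • intPoint (b i h) - r i) =O[𝓝[I] 0] (fun h => h)) ∧
      ∀ i j V, Bornology.IsBounded V → closure V ⊆ B i ∩ B j →
        ∀ᶠ h in 𝓝[I] 0, ∀ x ∈ L i h ∩ V, ∀ ζ ζ', (X i).Labels h ζ x → (X j).Labels h ζ' x →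
          (A j).1.mulVec ζ' + b j h = (A i).1.mulVec ζ + b i h := by
  classical
  obtain ⟨A, κ, c, hO, hrel, hcoc⟩ := T.exists_transition
  obtain ⟨f, hf⟩ := exists_coboundary B T.isOpen T.preconnected T.union_simplyConnected
    (fun i j => (A i j)⁻¹) (fun i j k hijk => by
      rw [← (hcoc i j k hijk).1, mul_inv_rev])
  have hfA : ∀ i j, (B i ∩ B j).Nonempty → f j * A i j = f i := fun i j hij => by
    rw [hf i j hij, inv_mul_cancel_right]
  -- the translation parts satisfy the cocycle condition only for small `h`, and are set to zero
  -- for the other values of `h`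
  set good : ℝ → Prop := fun h => ∀ i j k, (B i ∩ B j ∩ B k).Nonempty →
    (A j k).1.mulVec (κ i j h) + κ j k h = κ i k h
  have hgood : ∀ᶠ h in 𝓝[I] (0 : ℝ), good h := by
    simp only [good, eventually_all]
    intro i j k hijk
    exact (hcoc i j k hijk).2
  set m : Fin q → Fin q → ℝ → Fin 2 → ℤ := fun i j h =>
    if good h then (f j).1.mulVec (κ i j h) else 0
  obtain ⟨s, hs⟩ := exists_coboundary (G := Multiplicative (ℝ → Fin 2 → ℤ)) B T.isOpen
    T.preconnected T.union_simplyConnected (fun i j => Multiplicative.ofAdd (m i j))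
    (fun i j k hijk => by
      rw [← ofAdd_add]
      congr 1
      funext h
      simp only [m, Pi.add_apply]
      split_ifs with hg
      · have hjk : (B j ∩ B k).Nonempty := hijk.mono fun x hx => ⟨hx.1.2, hx.2⟩
        rw [← hg i j k hijk, Matrix.mulVec_add, Matrix.mulVec_mulVec,
          ← Matrix.SpecialLinearGroup.coe_mul, hfA j k hjk]
      · rw [add_zero])
  have hs' : ∀ i j, (B i ∩ B j).Nonempty → ∀ h,
      (s j).toAdd h = (s i).toAdd h + m i j h := fun i j hij h => by
    rw [hs i j hij]
    rfl
  obtain ⟨x₀, hx₀⟩ := T.union_simplyConnected.nonempty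
  obtain ⟨i₀, -⟩ := mem_iUnion.1 hx₀
  set b : Fin q → ℝ → Fin 2 → ℤ := fun i h => (s i₀).toAdd h - (s i).toAdd h
  have hb : ∀ i j, (B i ∩ B j).Nonempty → ∀ᶠ h in 𝓝[I] (0 : ℝ),
      b i h = b j h + (f j).1.mulVec (κ i j h) := by
    intro i j hij
    filter_upwards [hgood] with h hh
    simp only [b]
    rw [hs' i j hij h]
    simp only [m, if_pos hh]
    abel
  have hbound : ∀ i, ∃ r : Plane,
      (fun h : ℝ => h • intPoint (b i h) - r) =O[𝓝[I] 0] (fun h => h) := by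
    have hstep : ∀ i j, (B i ∩ B j).Nonempty →
        (∃ r : Plane, (fun h : ℝ => h • intPoint (b j h) - r) =O[𝓝[I] 0] (fun h => h)) →
        ∃ r : Plane, (fun h : ℝ => h • intPoint (b i h) - r) =O[𝓝[I] 0] (fun h => h) := by
      rintro i j hij ⟨r, hr⟩
      refine ⟨r + intMap (f j).1 (c i j), ?_⟩
      have h1 := (intMap (f j).1).isBigO_comp (fun h : ℝ => h • intPoint (κ i j h) - c i j) (𝓝[I] 0)
      refine (hr.add (h1.trans (hO i j hij))).congr' ?_ EventuallyEq.rfl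
      filter_upwards [hb i j hij] with h hh
      rw [hh, intPoint_add, map_sub, map_smul, intMap_intPoint, smul_add]
      abel
    have hT := IsPreconnected.eq_of_overlap T.isOpen T.nonempty
      T.union_simplyConnected.isPathConnected.isConnected.isPreconnected
      (T := fun i => ∃ r : Plane,
        (fun h : ℝ => h • intPoint (b i h) - r) =O[𝓝[I] 0] (fun h => h))
      (fun i j hij => propext ⟨hstep j i (by rwa [inter_comm]), hstep i j hij⟩)
    intro i
    rw [hT i i₀]
    refine ⟨0, ?_⟩
    have e : ∀ h : ℝ, h • intPoint (b i₀ h) - 0 = 0 := fun h => by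
      ext k
      simp [b]
    simp only [e]
    exact Asymptotics.isBigO_zero _ _
  choose r hr using hbound
  refine ⟨f, b, r, hr, fun i j V hVb hV => ?_⟩
  by_cases hij : (B i ∩ B j).Nonempty
  · filter_upwards [hrel i j V hVb hV, hb i j hij] with h h1 h2 x hx ζ ζ' hζ hζ'
    rw [h1 x hx ζ ζ' hζ hζ', h2, Matrix.mulVec_add, Matrix.mulVec_mulVec,
      ← Matrix.SpecialLinearGroup.coe_mul, hfA i j hij]
    abel
  · have hV0 : V = ∅ := by
      rw [not_nonempty_iff_eq_empty] at hij
      rw [hij] at hV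
      exact subset_empty_iff.1 (subset_closure.trans hV)
    simp [hV0]

end IsAtlas

/-! ### Operations on charts -/

/-- An element of `SL(2, ℤ)`, as an automorphism of the plane. -/
noncomputable def intEquiv (A : Matrix.SpecialLinearGroup (Fin 2) ℤ) : Plane ≃L[ℝ] Plane :=
  ContinuousLinearEquiv.equivOfInverse (intMap A.1) (intMap A⁻¹.1)
    (fun x => by
      rw [← ContinuousLinearMap.comp_apply, ← intMap_mul, ← Matrix.SpecialLinearGroup.coe_mul,
        inv_mul_cancel, Matrix.SpecialLinearGroup.coe_one, intMap_one,
        ContinuousLinearMap.id_apply])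
    (fun x => by
      rw [← ContinuousLinearMap.comp_apply, ← intMap_mul, ← Matrix.SpecialLinearGroup.coe_mul,
        mul_inv_cancel, Matrix.SpecialLinearGroup.coe_one, intMap_one,
        ContinuousLinearMap.id_apply])

theorem intEquiv_apply (A : Matrix.SpecialLinearGroup (Fin 2) ℤ) (x : Plane) :
    intEquiv A x = intMap A.1 x := rfl

theorem intMap_scaledPoint (A : Matrix (Fin 2) (Fin 2) ℤ) (h : ℝ) (ζ : Fin 2 → ℤ) :
    intMap A (scaledPoint h ζ) = scaledPoint h (A.mulVec ζ) := by
  rw [scaledPoint_eq_smul, map_smul, intMap_intPoint, scaledPoint_eq_smul]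

theorem intEquiv_symm_scaledPoint (A : Matrix.SpecialLinearGroup (Fin 2) ℤ) (h : ℝ)
    (ζ : Fin 2 → ℤ) : (intEquiv A).symm (scaledPoint h (A.1.mulVec ζ)) = scaledPoint h ζ := by
  rw [ContinuousLinearEquiv.symm_apply_eq, intEquiv_apply, intMap_scaledPoint]

theorem exists_forall_le_of_eventually {I : Set ℝ} (hI : I ⊆ Ioi 0) {p : ℝ → Prop}
    (h : ∀ᶠ h in 𝓝[I] (0 : ℝ), p h) : ∃ h₁ > 0, ∀ h ∈ I, h ≤ h₁ → p h := by
  obtain ⟨ε, hε, hball⟩ := Metric.mem_nhdsWithin_iff.1 h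
  refine ⟨ε / 2, half_pos hε, fun h hh hle => hball ⟨?_, hh⟩⟩
  have hpos : 0 < h := hI hh
  rw [Metric.mem_ball, dist_zero_right, Real.norm_of_nonneg hpos.le]
  linarith

theorem eventually_of_forall_le {I : Set ℝ} {p : ℝ → Prop}
    (h : ∃ h₁ > 0, ∀ h ∈ I, h ≤ h₁ → p h) : ∀ᶠ h in 𝓝[I] (0 : ℝ), p h := by
  obtain ⟨h₁, hpos, hp⟩ := h
  filter_upwards [self_mem_nhdsWithin, mem_nhdsWithin_of_mem_nhds (Iic_mem_nhds hpos)]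
    with h hh hle using hp h hh hle

namespace ChartData

/-- The chart obtained from `X` by the change of variables `A ∈ SL(2, ℤ)`: it labels by `A ζ` the
points that `X` labels by `ζ`. -/
noncomputable def transform (X : ChartData) (A : Matrix.SpecialLinearGroup (Fin 2) ℤ) :
    ChartData where
  U := (intEquiv A).symm ⁻¹' X.U
  G h := X.G h ∘ (intEquiv A).symm
  g k := X.g k ∘ (intEquiv A).symm
  C := X.C

theorem Labels.transform {X : ChartData} (A : Matrix.SpecialLinearGroup (Fin 2) ℤ) {h : ℝ}
    {ζ : Fin 2 → ℤ} {x : Plane} (hl : X.Labels h ζ x) :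
    (X.transform A).Labels h (A.1.mulVec ζ) x := by
  simp only [Labels, ChartData.transform, mem_preimage, Function.comp_apply,
    intEquiv_symm_scaledPoint]
  exact hl

theorem HasExpansion.transform {X : ChartData} {I : Set ℝ} (hX : X.HasExpansion I)
    (hU : IsOpen X.U) (A : Matrix.SpecialLinearGroup (Fin 2) ℤ) :
    (X.transform A).HasExpansion I := by
  set e := (intEquiv A).symm
  refine ⟨fun h hh => (hX.1 h hh).comp e.contDiff.contDiffOn (mapsTo_preimage _ _),
    fun k => (hX.2.1 k).comp e.contDiff.contDiffOn (mapsTo_preimage _ _), fun N m => ?_⟩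
  obtain ⟨M, h₁, hpos, hM⟩ := hX.2.2 N m
  refine ⟨M * ‖(e : Plane →L[ℝ] Plane)‖ ^ m, h₁, hpos, fun h hh hle ξ hξ => ?_⟩
  have h1 := e.iteratedFDerivWithin_comp_right
    (fun η => X.G h η - ∑ k ∈ Finset.range (N + 1), h ^ k • X.g k η) hU.uniqueDiffOn (x := ξ) hξ m
  have h2 := hM h hh hle (e ξ) hξ
  change ‖iteratedFDerivWithin ℝ m
    ((fun η => X.G h η - ∑ k ∈ Finset.range (N + 1), h ^ k • X.g k η) ∘ e) (e ⁻¹' X.U) ξ‖ ≤ _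
  rw [h1]
  refine (ContinuousMultilinearMap.norm_compContinuousLinearMap_le _ _).trans ?_
  rw [Finset.prod_const, Finset.card_univ, Fintype.card_fin]
  calc _ ≤ (M * h ^ (N + 1)) * ‖(e : Plane →L[ℝ] Plane)‖ ^ m :=
        mul_le_mul_of_nonneg_right h2 (by positivity)
    _ = _ := by ring

theorem IsChart.transform {X : ChartData} {L : ℝ → Set Plane} {I : Set ℝ} {B : Set Plane}
    (hX : X.IsChart univ L I B) (A : Matrix.SpecialLinearGroup (Fin 2) ℤ) :
    (X.transform A).IsChart univ L I B where
  isOpen := hX.isOpen.preimage (intEquiv A).symm.continuous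
  isBounded := by
    have h := (intEquiv A).lipschitz.isBounded_image hX.isBounded
    rwa [ContinuousLinearEquiv.image_eq_preimage_symm] at h
  expansion := hX.expansion.transform hX.isOpen A
  injOn := hX.injOn.comp (intEquiv A).symm.injective.injOn (mapsTo_preimage _ _)
  orientation ξ hξ := by
    have h1 := ((hX.contDiffAt_g 0 hξ).differentiableAt (by simp)).hasFDerivAt
    have h2 := h1.comp ξ (intEquiv A).symm.hasFDerivAt
    change 0 < (fderiv ℝ (X.g 0 ∘ (intEquiv A).symm) ξ).det
    rw [h2.fderiv]
    change 0 < LinearMap.det ((fderiv ℝ (X.g 0) ((intEquiv A).symm ξ) : Plane →ₗ[ℝ] Plane) ∘ₗ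
      (intMap A⁻¹.1 : Plane →ₗ[ℝ] Plane))
    have h3 := det_intMap A⁻¹.1
    rw [ContinuousLinearMap.det, A⁻¹.2] at h3
    rw [LinearMap.det_comp, h3]
    simpa using hX.orientation _ hξ
  image_mem := by
    have : (X.transform A).g 0 '' (X.transform A).U = X.g 0 '' X.U := by
      change (X.g 0 ∘ (intEquiv A).symm) '' ((intEquiv A).symm ⁻¹' X.U) = _
      rw [image_comp, image_preimage_eq _ (intEquiv A).symm.surjective]
    rw [this]
    exact hX.image_mem
  C_pos := hX.C_pos
  exists_index h hh x hx := by
    obtain ⟨ζ, -, hζ⟩ := hX.exists_index h hh x hx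
    exact ⟨_, mem_univ _, hζ.transform A⟩
  exists_point U₀ hU₀ hcpt := by
    obtain ⟨h₁, hpos, H⟩ := hX.exists_point (intEquiv A ⁻¹' U₀)
      (hU₀.preimage (intEquiv A).continuous) (by
        have hcl : closure (intEquiv A ⁻¹' U₀) = intEquiv A ⁻¹' closure U₀ :=
          ((intEquiv A).toHomeomorph.preimage_closure U₀).symm
        rw [RelCompactIn, hcl]
        refine ⟨(intEquiv A).toHomeomorph.isCompact_preimage.2 hcpt.1, fun ξ hξ => ?_⟩
        have h1 := hcpt.2 hξ
        simpa [principalPreimage, ChartData.transform] using h1)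
    refine ⟨h₁, hpos, fun h hh hle ζ _ hζ => ?_⟩
    have e1 : A.1.mulVec (A⁻¹.1.mulVec ζ) = ζ := by
      rw [Matrix.mulVec_mulVec, ← Matrix.SpecialLinearGroup.coe_mul, mul_inv_cancel,
        Matrix.SpecialLinearGroup.coe_one, Matrix.one_mulVec]
    obtain ⟨x, hx, hl⟩ := H h hh hle (A⁻¹.1.mulVec ζ) (mem_univ _) (by
      rw [mem_preimage, intEquiv_apply, intMap_scaledPoint, e1]
      exact hζ)
    refine ⟨x, hx, ?_⟩
    have h1 := hl.transform A
    rwa [e1] at h1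

/-- The chart `X` with other constants in its `O(h^∞)` estimates. -/
def withConstants (X : ChartData) (C : ℕ → ℝ) : ChartData :=
  { X with C := C }

theorem IsChart.withConstants {X : ChartData} {Λ : Set (Fin 2 → ℤ)} {L : ℝ → Set Plane} {I : Set ℝ}
    {B : Set Plane} (hX : X.IsChart Λ L I B) (hI : I ⊆ Ioi 0) {C : ℕ → ℝ} (hC : ∀ N, X.C N ≤ C N) :
    (X.withConstants C).IsChart Λ L I B := by
  have hl : ∀ h ∈ I, ∀ ζ x, X.Labels h ζ x → (X.withConstants C).Labels h ζ x := by
    intro h hh ζ x hl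
    have hpos : 0 < h := hI hh
    exact ⟨hl.1, fun N => (hl.2 N).trans
      (mul_le_mul_of_nonneg_right (hC N) (by positivity))⟩
  exact {
    isOpen := hX.isOpen
    isBounded := hX.isBounded
    expansion := hX.expansion
    injOn := hX.injOn
    orientation := hX.orientation
    image_mem := hX.image_mem
    C_pos := fun N => (hX.C_pos N).trans_le (hC N)
    exists_index := fun h hh x hx => by
      obtain ⟨ζ, hζ, h1⟩ := hX.exists_index h hh x hx
      exact ⟨ζ, hζ, hl h hh ζ x h1⟩
    exists_point := fun U₀ hU₀ hcpt => by
      obtain ⟨h₁, hpos, H⟩ := hX.exists_point U₀ hU₀ hcpt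
      refine ⟨h₁, hpos, fun h hh hle ζ hζ hm => ?_⟩
      obtain ⟨x, hx, h1⟩ := H h hh hle ζ hζ hm
      exact ⟨x, hx, hl h hh ζ x h1⟩ }

/-- A chart for a family in `B` is a chart for its restriction to an open subset of `B`. -/
theorem IsChart.restrict {X : ChartData} {Λ : Set (Fin 2 → ℤ)} {L : ℝ → Set Plane} {I : Set ℝ}
    {B B' : Set Plane} (hX : X.IsChart Λ L I B) (hI : I ⊆ Ioi 0) (hB' : IsOpen B') (hsub : B' ⊆ B) :
    X.IsChart Λ (restrictFamily L B') I B' where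
  isOpen := hX.isOpen
  isBounded := hX.isBounded
  expansion := hX.expansion
  injOn := hX.injOn
  orientation := hX.orientation
  image_mem := nhdsSet_mono (closure_mono hsub) hX.image_mem
  C_pos := hX.C_pos
  exists_index h hh x hx := hX.exists_index h hh x hx.1
  exists_point U₀ hU₀ hcpt := by
    obtain ⟨h₁, hpos, H⟩ := hX.exists_point U₀ hU₀
      ⟨hcpt.1, hcpt.2.trans fun ξ hξ => ⟨hξ.1, hsub hξ.2⟩⟩
    obtain ⟨M, hMpos, hM⟩ := hX.exists_norm_sub_le hI
    have himg : IsCompact (X.g 0 '' closure U₀) :=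
      hcpt.1.image_of_continuousOn ((hX.contDiffOn_g 0).continuousOn.mono fun ξ hξ =>
        (hcpt.2 hξ).1)
    have hsubimg : X.g 0 '' closure U₀ ⊆ B' := by
      rintro _ ⟨ξ, hξ, rfl⟩
      exact (hcpt.2 hξ).2
    obtain ⟨δ, hδ, hthick⟩ := himg.exists_thickening_subset_open hB' hsubimg
    have hsmall : ∀ᶠ h in 𝓝[I] (0 : ℝ), M * h < δ := by
      have : Tendsto (fun h : ℝ => M * h) (𝓝[I] 0) (𝓝 (M * 0)) :=
        (tendsto_id.mono_left nhdsWithin_le_nhds).const_mul M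
      rw [mul_zero] at this
      exact this (Iio_mem_nhds hδ)
    obtain ⟨h₂, hpos₂, H₂⟩ := exists_forall_le_of_eventually hI (hM.and hsmall)
    refine ⟨min h₁ h₂, lt_min hpos hpos₂, fun h hh hle ζ hζ hm => ?_⟩
    obtain ⟨x, hx, hl⟩ := H h hh (hle.trans (min_le_left _ _)) ζ hζ hm
    obtain ⟨h3, h4⟩ := H₂ h hh (hle.trans (min_le_right _ _))
    refine ⟨x, ⟨hx, hthick (Metric.mem_thickening_iff.2
      ⟨_, mem_image_of_mem _ (subset_closure hm), ?_⟩)⟩, hl⟩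
    rw [dist_eq_norm]
    exact (h3 x ζ hl).trans_lt h4

/-- A labelling that is affine in the labels of a chart for small `h`, and zero for the other
values of `h`, is linear: when `h` is bounded below, the `O(h^∞)` estimates, with large enough
constants, allow one and the same label for all points. -/
theorem IsChart.exists_goodLabelling {X : ChartData} {Λ : Set (Fin 2 → ℤ)} {L : ℝ → Set Plane}
    {I : Set ℝ} {B : Set Plane} (hX : X.IsChart Λ L I B) (hI : I ⊆ Ioi 0)
    (hB : Bornology.IsBounded B) (hLB : ∀ h ∈ I, L h ⊆ B) {h₁ : ℝ} (h₁pos : 0 < h₁)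
    {A : Matrix (Fin 2) (Fin 2) ℤ} {b : ℝ → Fin 2 → ℤ} {ℓ : ℝ → Plane → Fin 2 → ℤ}
    (hsmall : ∀ h ∈ I, h ≤ h₁ → ∀ x ∈ L h, ∀ ζ, X.Labels h ζ x → ℓ h x = A.mulVec ζ + b h)
    (hlarge : ∀ h, h₁ < h → ∀ x, ℓ h x = 0) :
    ∃ C : ℕ → ℝ, (∀ N, X.C N ≤ C N) ∧ ∃ ℓ₀ : ℝ → Plane → Fin 2 → ℤ,
      IsGoodLabelling (X.withConstants C) L I ℓ₀ ∧
      ∃ κ : ℝ → Fin 2 → ℤ, ∀ h ∈ I, ∀ x ∈ L h, ℓ h x = A.mulVec (ℓ₀ h x) + κ h := by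
  classical
  have hlab : ∀ h x, ∃ ζ, h ∈ I → x ∈ L h → X.Labels h ζ x := by
    intro h x
    by_cases hx : h ∈ I ∧ x ∈ L h
    · obtain ⟨ζ, -, hζ⟩ := hX.exists_index h hx.1 x hx.2
      exact ⟨ζ, fun _ _ => hζ⟩
    · exact ⟨0, fun h1 h2 => absurd ⟨h1, h2⟩ hx⟩
  choose lab hlab using hlab
  have hpt : ∀ h, ∃ x₀, (L h).Nonempty → x₀ ∈ L h := by
    intro h
    by_cases hn : (L h).Nonempty
    · exact ⟨hn.some, fun _ => hn.some_mem⟩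
    · exact ⟨0, fun h' => absurd h' hn⟩
  choose pt hpt using hpt
  set D : ℝ := Metric.diam B
  have hD : 0 ≤ D := Metric.diam_nonneg
  have hC0 := (hX.C_pos 0).le
  refine ⟨fun N => X.C N + (X.C 0 + D) / h₁ ^ N, fun N => ?_,
    fun h x => if h ≤ h₁ then lab h x else lab h (pt h), ?_,
    fun h => if h ≤ h₁ then b h else -A.mulVec (lab h (pt h)), ?_⟩
  · have : 0 ≤ (X.C 0 + D) / h₁ ^ N := by positivity
    linarith
  · intro h hh x hx
    have hpos : 0 < h := hI hh
    dsimp only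
    split_ifs with hle
    · refine ⟨(hlab h x hh hx).1, fun N => ((hlab h x hh hx).2 N).trans ?_⟩
      refine mul_le_mul_of_nonneg_right ?_ (by positivity)
      have : 0 ≤ (X.C 0 + D) / h₁ ^ N := by positivity
      change X.C N ≤ X.C N + _
      linarith
    · have hx₀ := hpt h ⟨x, hx⟩
      have hl := hlab h (pt h) hh hx₀
      refine ⟨hl.1, fun N => ?_⟩
      have h1 : ‖x - pt h‖ ≤ D := by
        rw [← dist_eq_norm]
        exact Metric.dist_le_diam_of_mem hB (hLB h hh hx) (hLB h hh hx₀)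
      have h2 := hl.2 0
      rw [pow_zero, mul_one] at h2
      have h3 : ‖x - X.G h (scaledPoint h (lab h (pt h)))‖ ≤ X.C 0 + D := by
        rw [← sub_add_sub_cancel x (pt h)]
        exact (norm_add_le _ _).trans (by linarith)
      refine h3.trans ?_
      change _ ≤ (X.C N + (X.C 0 + D) / h₁ ^ N) * h ^ N
      have h4 : h₁ ^ N ≤ h ^ N := pow_le_pow_left₀ h₁pos.le (not_le.1 hle).le N
      have h5 : X.C 0 + D ≤ (X.C 0 + D) / h₁ ^ N * h ^ N := by
        rw [div_mul_eq_mul_div, le_div_iff₀ (by positivity)]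
        exact mul_le_mul_of_nonneg_left h4 (by positivity)
      have h6 : 0 ≤ X.C N * h ^ N := mul_nonneg (hX.C_pos N).le (by positivity)
      linarith
  · intro h hh x hx
    dsimp only
    split_ifs with hle
    · exact hsmall h hh hle x hx _ (hlab h x hh hx)
    · rw [hlarge h (not_le.1 hle), add_neg_cancel]

end ChartData

/-! ### Global labellings -/

/-- On each set `B' i`, and for small `h`, the values of `ℓ` are the images of the labels of the
chart `X i` by an affine map of `ℤ²` with fixed linear part in `SL(2, ℤ)`. -/
def IsPiecewiseAffine (I : Set ℝ) {q : ℕ} (B' : Fin q → Set Plane) (L : Fin q → ℝ → Set Plane)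
    (X : Fin q → ChartData) (ℓ : ℝ → Plane → Fin 2 → ℤ) : Prop :=
  ∀ i, ∃ (A : Matrix.SpecialLinearGroup (Fin 2) ℤ) (κ : ℝ → Fin 2 → ℤ),
    ∀ᶠ h in 𝓝[I] (0 : ℝ), ∀ x ∈ L i h ∩ B' i, ∀ ζ, (X i).Labels h ζ x →
      ℓ h x = A.1.mulVec ζ + κ h

namespace IsAtlas

variable {I : Set ℝ} {q : ℕ} {B B' : Fin q → Set Plane} {L : Fin q → ℝ → Set Plane}
  {X : Fin q → ChartData} {Λ : Fin q → Set (Fin 2 → ℤ)} {H : Fin q → Set Plane}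

/-- The labels of any other chart of a restricted family are affine functions of those of the
atlas. -/
theorem exists_affine_of_chart (T : IsAtlas I B B' L X Λ H) (i : Fin q) {Y : ChartData}
    {Λ' : Set (Fin 2 → ℤ)} {H' : Set Plane} (hΛ' : IsIndexModel Λ' H')
    (hY : Y.IsChart Λ' (restrictFamily (L i) (B' i)) I (B' i)) :
    ∃ (A : Matrix.SpecialLinearGroup (Fin 2) ℤ) (κ : ℝ → Fin 2 → ℤ),
      ∀ᶠ h in 𝓝[I] (0 : ℝ), ∀ x ∈ L i h ∩ B' i, ∀ ζ ζ', (X i).Labels h ζ x → Y.Labels h ζ' x →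
        ζ' = A.1.mulVec ζ + κ h := by
  have := T.neBot
  have hsub : B' i ⊆ B i := subset_closure.trans (T.closure_subset i)
  have P : (X i).IsPair Y (Λ i) Λ' (H i) H' (L i) (restrictFamily (L i) (B' i)) I (B i) (B' i)
      (B' i) :=
    { pos := T.pos
      chart := T.chart i
      chart' := hY
      model := T.model i
      model' := hΛ'
      isOpen := T.isOpen' i
      subset := hsub
      subset' := subset_rfl
      agree := fun h _ => by rw [restrictFamily, inter_assoc, inter_self] }
  obtain ⟨A, κ, -, -, h⟩ := P.exists_affine (T.connected' i)
  exact ⟨A, κ, h (B' i) ((T.isBounded i).subset hsub)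
    ((T.closure_subset i).trans (T.chart i).subset_image) hY.closure_subset (T.near' i)⟩

theorem isPiecewiseAffine_of_isGlobalLabelling (T : IsAtlas I B B' L X Λ H) {p : ℕ}
    {ℓ : ℝ → Plane → Fin 2 → ℤ} (hℓ : IsGlobalLabelling I p B' L ℓ) :
    IsPiecewiseAffine I B' L X ℓ := by
  intro i
  rcases lt_or_ge (i : ℕ) p with hi | hi
  · obtain ⟨Y, hY, ℓ₀, hgood, κ, hκ⟩ := hℓ.1 i hi
    obtain ⟨A, κ', h⟩ := T.exists_affine_of_chart i isIndexModel_univ hY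
    refine ⟨A, fun h => κ' h + κ h, ?_⟩
    filter_upwards [h, self_mem_nhdsWithin] with h h1 hh x hx ζ hζ
    rw [hκ h hh x hx, h1 x hx ζ _ hζ (hgood h hh x hx), add_assoc]
  · obtain ⟨Y, hY, ℓ₀, hgood, A₀, κ, hκ⟩ := hℓ.2 i hi
    obtain ⟨A, κ', h⟩ := T.exists_affine_of_chart i isIndexModel_upper hY.1
    refine ⟨A₀ * A, fun h => A₀.1.mulVec (κ' h) + κ h, ?_⟩
    filter_upwards [h, self_mem_nhdsWithin] with h h1 hh x hx ζ hζ
    rw [hκ h hh x hx, h1 x hx ζ _ hζ (hgood h hh x hx), Matrix.mulVec_add, Matrix.mulVec_mulVec,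
      Matrix.SpecialLinearGroup.coe_mul, add_assoc]

theorem exists_mem_piece (T : IsAtlas I B B' L X Λ H) {h : ℝ} (hh : h ∈ I) {x : Plane}
    (hx : x ∈ (⋃ i, L i h) ∩ ⋃ i, B' i) : ∃ i, x ∈ L i h ∩ B' i := by
  obtain ⟨i, hi⟩ := mem_iUnion.1 hx.1
  obtain ⟨j, hj⟩ := mem_iUnion.1 hx.2
  exact ⟨j, T.mem_of_mem_inter hh hi (T.closure_subset j (subset_closure hj)), hj⟩

/-- Two affine functions of a piecewise affine `ℓ` that agree near one limit point are equal. -/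
theorem affine_comp_unique (T : IsAtlas I B B' L X Λ H) {ℓ : ℝ → Plane → Fin 2 → ℤ}
    (hℓ : IsPiecewiseAffine I B' L X ℓ) {i : Fin q} {N : Set Plane} (hN : IsOpen N)
    (hNB : N ⊆ B' i) (hne : (N ∩ limitPoints (L i) I).Nonempty)
    {P P' : Matrix.SpecialLinearGroup (Fin 2) ℤ} {κ κ' : ℝ → Fin 2 → ℤ}
    (h : ∀ᶠ h in 𝓝[I] (0 : ℝ), ∀ x ∈ L i h ∩ N,
      P.1.mulVec (ℓ h x) + κ h = P'.1.mulVec (ℓ h x) + κ' h) :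
    P = P' ∧ ∀ᶠ h in 𝓝[I] (0 : ℝ), κ h = κ' h := by
  have := T.neBot
  obtain ⟨x, hxN, hx⟩ := hne
  obtain ⟨A, b, hA⟩ := hℓ i
  have hxB := T.closure_subset i (subset_closure (hNB hxN))
  obtain ⟨h1, h2⟩ := (T.chart i).affine_unique T.pos (T.model i) (hN.mem_nhds hxN)
    ((T.isOpen i).mem_nhds hxB) hx (A := P.1 * A.1) (A' := P'.1 * A.1)
    (κ := fun h => P.1.mulVec (b h) + κ h) (κ' := fun h => P'.1.mulVec (b h) + κ' h) (by
      filter_upwards [h, hA] with h e1 e2 y hy ζ hζ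
      have e3 := e1 y hy
      rw [e2 y ⟨hy.1, hNB hy.2⟩ ζ hζ, Matrix.mulVec_add, Matrix.mulVec_add, Matrix.mulVec_mulVec,
        Matrix.mulVec_mulVec, add_assoc, add_assoc] at e3
      exact e3)
  have hP : P = P' := mul_right_cancel (b := A) (Subtype.ext h1)
  refine ⟨hP, h2.mono fun h hh => ?_⟩
  rw [hP] at hh
  exact add_left_cancel hh

/-- Two global labellings differ by an affine map of `ℤ²` with fixed linear part. -/
theorem exists_affine_relation (T : IsAtlas I B B' L X Λ H) {ℓ ℓ' : ℝ → Plane → Fin 2 → ℤ}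
    (hℓ : IsPiecewiseAffine I B' L X ℓ) (hℓ' : IsPiecewiseAffine I B' L X ℓ') :
    ∃ (P : Matrix.SpecialLinearGroup (Fin 2) ℤ) (κ : ℝ → Fin 2 → ℤ),
      ∀ᶠ h in 𝓝[I] (0 : ℝ), ∀ x ∈ (⋃ i, L i h) ∩ ⋃ i, B' i,
        ℓ' h x = P.1.mulVec (ℓ h x) + κ h := by
  have := T.neBot
  have hex : ∀ i, ∃ (P : Matrix.SpecialLinearGroup (Fin 2) ℤ) (κ : ℝ → Fin 2 → ℤ),
      ∀ᶠ h in 𝓝[I] (0 : ℝ), ∀ x ∈ L i h ∩ B' i, ℓ' h x = P.1.mulVec (ℓ h x) + κ h := by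
    intro i
    obtain ⟨A, b, hA⟩ := hℓ i
    obtain ⟨A', b', hA'⟩ := hℓ' i
    refine ⟨A' * A⁻¹, fun h => b' h - (A' * A⁻¹).1.mulVec (b h), ?_⟩
    filter_upwards [hA, hA', self_mem_nhdsWithin] with h h1 h2 hh x hx
    obtain ⟨ζ, -, hζ⟩ := (T.chart i).exists_index h hh x hx.1
    rw [h1 x hx ζ hζ, h2 x hx ζ hζ, Matrix.mulVec_add, Matrix.mulVec_mulVec,
      ← Matrix.SpecialLinearGroup.coe_mul, inv_mul_cancel_right]
    abel
  choose P κ hPκ using hex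
  have hover : ∀ i j, (B' i ∩ B' j).Nonempty →
      P i = P j ∧ ∀ᶠ h in 𝓝[I] (0 : ℝ), κ i h = κ j h := by
    intro i j hij
    refine T.affine_comp_unique hℓ ((T.isOpen' i).inter (T.isOpen' j)) inter_subset_left
      (T.overlap' i j hij) ?_
    filter_upwards [hPκ i, hPκ j, self_mem_nhdsWithin] with h h1 h2 hh x hx
    rw [← h1 x ⟨hx.1, hx.2.1⟩, ← h2 x ⟨T.mem_of_mem_inter hh hx.1
      (T.closure_subset j (subset_closure hx.2.2)), hx.2.2⟩]
  have hconst : ∀ i j, ((P i, (κ i : Germ (𝓝[I] (0 : ℝ)) (Fin 2 → ℤ))) : _ × _)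
      = (P j, (κ j : Germ (𝓝[I] (0 : ℝ)) (Fin 2 → ℤ))) :=
    IsPreconnected.eq_of_overlap T.isOpen' T.nonempty' T.union_preconnected' fun i j hij =>
      Prod.ext (hover i j hij).1 (Germ.coe_eq.2 (hover i j hij).2)
  obtain ⟨x₀, hx₀⟩ := T.union_simplyConnected.nonempty
  obtain ⟨i₀, -⟩ := mem_iUnion.1 hx₀
  refine ⟨P i₀, κ i₀, ?_⟩
  have hall : ∀ᶠ h in 𝓝[I] (0 : ℝ), ∀ i, κ i h = κ i₀ h ∧
      ∀ x ∈ L i h ∩ B' i, ℓ' h x = (P i).1.mulVec (ℓ h x) + κ i h :=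
    eventually_all.2 fun i => (Germ.coe_eq.1 (Prod.ext_iff.1 (hconst i i₀)).2).and (hPκ i)
  filter_upwards [hall, self_mem_nhdsWithin] with h h1 hh x hx
  obtain ⟨i, hi⟩ := T.exists_mem_piece hh hx
  have hP : P i = P i₀ := (Prod.ext_iff.1 (hconst i i₀)).1
  rw [(h1 i).2 x hi, (h1 i).1, hP]

/-- Two global labellings that agree on one piece agree everywhere. -/
theorem agreeForSmall (T : IsAtlas I B B' L X Λ H) {ℓ ℓ' : ℝ → Plane → Fin 2 → ℤ}
    (hℓ : IsPiecewiseAffine I B' L X ℓ) (hℓ' : IsPiecewiseAffine I B' L X ℓ') {i : Fin q}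
    (h : AgreeForSmall I (fun h => L i h ∩ B' i) ℓ ℓ') :
    AgreeForSmall I (fun h => (⋃ i, L i h) ∩ ⋃ i, B' i) ℓ ℓ' := by
  obtain ⟨P, κ, hP⟩ := T.exists_affine_relation hℓ hℓ'
  have h0 : ∀ᶠ h in 𝓝[I] (0 : ℝ), ∀ x ∈ L i h ∩ B' i, ℓ h x = ℓ' h x := eventually_of_forall_le h
  obtain ⟨h1, h2⟩ := T.affine_comp_unique hℓ (T.isOpen' i) subset_rfl (T.connected' i).nonempty
    (P := 1) (P' := P) (κ := 0) (κ' := κ) (by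
      filter_upwards [hP, h0] with h e1 e2 x hx
      rw [← e1 x ⟨mem_iUnion_of_mem i hx.1, mem_iUnion_of_mem i hx.2⟩, ← e2 x hx]
      simp)
  refine exists_forall_le_of_eventually T.pos ?_
  filter_upwards [hP, h2] with h e1 e2 x hx
  rw [e1 x hx, ← e2, ← h1]
  simp

/-- A global labelling, obtained by gluing the labels of the charts. It is normalized so that no
translation is needed to approximate it by a smooth map. -/
theorem exists_isGlobalLabelling (T : IsAtlas I B B' L X Λ H) {p : ℕ}
    (hlat : ∀ i : Fin q, (i : ℕ) < p → Λ i = univ)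
    (hhalf : ∀ i : Fin q, p ≤ (i : ℕ) → Λ i = upperIndices ∧
      Convex ℝ ((X i).principalPreimage (B' i)) ∧ ∃ ξ ∈ (X i).principalPreimage (B' i), ξ 1 = 0) :
    ∃ ℓ, IsGlobalLabelling I p B' L ℓ ∧
      ∃ (A : Fin q → Matrix.SpecialLinearGroup (Fin 2) ℤ) (r : Fin q → Plane),
        ∀ j (K : Set Plane), IsCompact K → K ⊆ B j → ∃ C : ℝ, ∀ᶠ h in 𝓝[I] (0 : ℝ),
          ∀ x ∈ (⋃ i, L i h) ∩ ⋃ i, B' i, x ∈ K →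
            ‖intMap (A j).1 ((X j).coord x) + r j - scaledPoint h (ℓ h x)‖ ≤ C * h := by
  classical
  have := T.neBot
  obtain ⟨A, b, r, hr, hglue⟩ := T.exists_gluing
  have hsub : ∀ i, B' i ⊆ B i := fun i => subset_closure.trans (T.closure_subset i)
  have hbdd : ∀ i, Bornology.IsBounded (B' i) := fun i => (T.isBounded i).subset (hsub i)
  have hmatch : ∀ᶠ h in 𝓝[I] (0 : ℝ), ∀ i j, ∀ x ∈ L i h ∩ (B' i ∩ B' j), ∀ ζ ζ',
      (X i).Labels h ζ x → (X j).Labels h ζ' x →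
        (A j).1.mulVec ζ' + b j h = (A i).1.mulVec ζ + b i h :=
    eventually_all.2 fun i => eventually_all.2 fun j =>
      hglue i j _ ((hbdd i).subset inter_subset_left)
        ((closure_inter_subset_inter_closure _ _).trans
          (inter_subset_inter (T.closure_subset i) (T.closure_subset j)))
  obtain ⟨h₁, h₁pos, hh₁⟩ := exists_forall_le_of_eventually T.pos hmatch
  set Q : ℝ → Plane → Fin q × (Fin 2 → ℤ) → Prop := fun h x s =>
    x ∈ L s.1 h ∩ B' s.1 ∧ (X s.1).Labels h s.2 x
  set ℓ : ℝ → Plane → Fin 2 → ℤ := fun h x =>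
    if hx : h ≤ h₁ ∧ ∃ s, Q h x s then
      (A hx.2.choose.1).1.mulVec hx.2.choose.2 + b hx.2.choose.1 h else 0
  have hsmall : ∀ i, ∀ h ∈ I, h ≤ h₁ → ∀ x ∈ L i h ∩ B' i, ∀ ζ, (X i).Labels h ζ x →
      ℓ h x = (A i).1.mulVec ζ + b i h := by
    intro i h hh hle x hx ζ hζ
    have hx' : h ≤ h₁ ∧ ∃ s, Q h x s := ⟨hle, (i, ζ), hx, hζ⟩
    have hs := hx'.2.choose_spec
    simp only [ℓ, dif_pos hx']
    exact hh₁ h hh hle i _ x ⟨hx.1, hx.2, hs.1.2⟩ ζ _ hζ hs.2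
  have hlarge : ∀ h, h₁ < h → ∀ x, ℓ h x = 0 := by
    intro h hlt x
    have : ¬ (h ≤ h₁ ∧ ∃ s, Q h x s) := fun hc => absurd hc.1 (not_le.2 hlt)
    simp only [ℓ, dif_neg this]
  have hlin : ∀ i, ∃ C : ℕ → ℝ, (∀ N, (X i).C N ≤ C N) ∧ ∃ ℓ₀ : ℝ → Plane → Fin 2 → ℤ,
      IsGoodLabelling ((X i).withConstants C) (restrictFamily (L i) (B' i)) I ℓ₀ ∧
      ∃ κ : ℝ → Fin 2 → ℤ, ∀ h ∈ I, ∀ x ∈ restrictFamily (L i) (B' i) h,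
        ℓ h x = (A i).1.mulVec (ℓ₀ h x) + κ h := fun i =>
    ((T.chart i).restrict T.pos (T.isOpen' i) (hsub i)).exists_goodLabelling T.pos (hbdd i)
      (fun h _ => inter_subset_right) h₁pos (hsmall i) hlarge
  refine ⟨ℓ, ⟨fun i hi => ?_, fun i hi => ?_⟩, A, r, fun j K hK hKB => ?_⟩
  · obtain ⟨C, hC, ℓ₀, hgood, κ, hκ⟩ := hlin i
    have hchart := ((T.chart i).restrict T.pos (T.isOpen' i) (hsub i)).withConstants T.pos hC
    rw [hlat i hi] at hchart
    exact ⟨_, hchart.transform (A i), fun h x => (A i).1.mulVec (ℓ₀ h x),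
      fun h hh x hx => (hgood h hh x hx).transform (A i), κ, hκ⟩
  · obtain ⟨C, hC, ℓ₀, hgood, κ, hκ⟩ := hlin i
    have hchart := ((T.chart i).restrict T.pos (T.isOpen' i) (hsub i)).withConstants T.pos hC
    obtain ⟨hΛ, hconv, hne⟩ := hhalf i hi
    rw [hΛ] at hchart
    exact ⟨_, ⟨hchart, hconv, hne⟩, ℓ₀, hgood, A i, κ, hκ⟩
  · obtain ⟨C, hC⟩ := (T.chart j).exists_norm_coord_sub_le T.pos hK
      (hKB.trans (T.chart j).subset_image)
    obtain ⟨C', hC'⟩ := (hr j).bound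
    have hcomp : ∀ᶠ h in 𝓝[I] (0 : ℝ), ∀ i, ∀ x ∈ L i h ∩ (B' i ∩ K), ∀ ζ ζ',
        (X i).Labels h ζ x → (X j).Labels h ζ' x →
          (A j).1.mulVec ζ' + b j h = (A i).1.mulVec ζ + b i h :=
      eventually_all.2 fun i => hglue i j _ ((hbdd i).subset inter_subset_left)
        ((closure_inter_subset_inter_closure _ _).trans
          (inter_subset_inter (T.closure_subset i) (hK.isClosed.closure_eq.subset.trans hKB)))
    refine ⟨‖intMap (A j).1‖ * C + C', ?_⟩
    filter_upwards [hC, hC', hcomp, self_mem_nhdsWithin,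
      eventually_of_forall_le ⟨h₁, h₁pos, fun h hh hle => (⟨hh, hle⟩ : h ∈ I ∧ h ≤ h₁)⟩]
      with h e1 e2 e3 hh hle x hx hxK
    obtain ⟨i, hi⟩ := T.exists_mem_piece hh hx
    obtain ⟨ζ, -, hζ⟩ := (T.chart i).exists_index h hh x hi.1
    obtain ⟨ζ', -, hζ'⟩ := (T.chart j).exists_index h hh x
      (T.mem_of_mem_inter hh hi.1 (hKB hxK))
    have hpos : 0 < h := T.pos hh
    rw [hsmall i h hh hle.2 x hi ζ hζ, ← e3 i x ⟨hi.1, hi.2, hxK⟩ ζ ζ' hζ hζ']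
    have e : intMap (A j).1 ((X j).coord x) + r j - scaledPoint h ((A j).1.mulVec ζ' + b j h)
        = intMap (A j).1 ((X j).coord x - scaledPoint h ζ') - (h • intPoint (b j h) - r j) := by
      rw [map_sub, intMap_scaledPoint, scaledPoint_eq_smul, scaledPoint_eq_smul, intPoint_add,
        smul_add]
      abel
    rw [e]
    rw [Real.norm_of_nonneg hpos.le] at e2
    have e4 := ((intMap (A j).1).le_opNorm ((X j).coord x - scaledPoint h ζ')).trans
      (mul_le_mul_of_nonneg_left (e1 x hxK ζ' hζ') (norm_nonneg _))
    calc _ ≤ ‖intMap (A j).1‖ * (C * h) + C' * h := (norm_sub_le _ _).trans (add_le_add e4 e2)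
      _ = _ := by ring

end IsAtlas

/-! ### Smooth approximation -/

namespace IsAtlas

variable {I : Set ℝ} {q : ℕ} {B B' : Fin q → Set Plane} {L : Fin q → ℝ → Set Plane}
  {X : Fin q → ChartData} {Λ : Fin q → Set (Fin 2 → ℤ)} {H : Fin q → Set Plane}

/-- Local smooth approximations of a labelling are averaged by a partition of unity subordinate
to the sets `B i`. They need not agree with each other away from the limit points. -/
theorem exists_contDiff_approx (T : IsAtlas I B B' L X Λ H) {ℓ : ℝ → Plane → Fin 2 → ℤ}
    {A : Fin q → Matrix.SpecialLinearGroup (Fin 2) ℤ} {r : Fin q → Plane}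
    (happrox : ∀ j (K : Set Plane), IsCompact K → K ⊆ B j → ∃ C : ℝ, ∀ᶠ h in 𝓝[I] (0 : ℝ),
      ∀ x ∈ (⋃ i, L i h) ∩ ⋃ i, B' i, x ∈ K →
        ‖intMap (A j).1 ((X j).coord x) + r j - scaledPoint h (ℓ h x)‖ ≤ C * h) :
    ∃ Φ : Plane → Plane, ContDiff ℝ ∞ Φ ∧ ∃ K > 0, ∀ᶠ h in 𝓝[I] (0 : ℝ),
      ∀ x ∈ (⋃ i, L i h) ∩ ⋃ i, B' i, ‖Φ x - scaledPoint h (ℓ h x)‖ ≤ K * h := by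
  obtain ⟨f, hf⟩ := SmoothPartitionOfUnity.exists_isSubordinate (modelWithCornersSelf ℝ Plane)
    (s := ⋃ i, closure (B' i)) (isClosed_iUnion_of_finite fun i => isClosed_closure) B T.isOpen
    (iUnion_mono T.closure_subset)
  set F : Fin q → Plane → Plane := fun j x => intMap (A j).1 ((X j).coord x) + r j
  have hcpt : ∀ j, IsCompact (tsupport (f j)) := fun j =>
    ((T.isBounded j).subset (hf j)).isCompact_closure.of_isClosed_subset (isClosed_tsupport _)
      subset_closure
  choose C hC using fun j => happrox j (tsupport (f j)) (hcpt j) (hf j)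
  refine ⟨fun x => ∑ j, f j x • F j x, ?_, ∑ j, |C j| + 1, by positivity, ?_⟩
  · refine ContDiff.sum fun j _ => contDiff_iff_contDiffAt.2 fun x => ?_
    by_cases hx : x ∈ tsupport (f j)
    · have h1 : ContDiffAt ℝ ∞ (X j).coord x :=
        (T.chart j).contDiffAt_coord ((T.chart j).subset_image (hf j hx))
      have h2 : ContDiffAt ℝ ∞ (f j) x := (f j).contMDiff.contDiff.contDiffAt
      exact h2.smul (((intMap (A j).1).contDiff.contDiffAt.comp x h1).add contDiffAt_const)
    · refine (contDiffAt_const (c := (0 : Plane))).congr_of_eventuallyEq ?_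
      filter_upwards [(isClosed_tsupport (f j)).isOpen_compl.mem_nhds hx] with y hy
      rw [image_eq_zero_of_notMem_tsupport hy, zero_smul]
  · filter_upwards [eventually_all.2 hC, self_mem_nhdsWithin] with h h1 hh x hx
    have hpos : 0 < h := T.pos hh
    have hxs : x ∈ ⋃ i, closure (B' i) := iUnion_mono (fun i => subset_closure) hx.2
    have hsum : ∑ j, f j x = 1 := by
      rw [← finsum_eq_sum_of_fintype]
      exact f.sum_eq_one hxs
    have e : ∑ j, f j x • F j x - scaledPoint h (ℓ h x)
        = ∑ j, f j x • (F j x - scaledPoint h (ℓ h x)) := by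
      simp only [smul_sub, Finset.sum_sub_distrib]
      rw [← Finset.sum_smul, hsum, one_smul]
    rw [e]
    have hterm : ∀ j, ‖f j x • (F j x - scaledPoint h (ℓ h x))‖ ≤ |C j| * h := by
      intro j
      rw [norm_smul, Real.norm_of_nonneg (f.nonneg j x)]
      by_cases hxj : x ∈ tsupport (f j)
      · have h2 : ‖F j x - scaledPoint h (ℓ h x)‖ ≤ |C j| * h :=
          (h1 j x hx hxj).trans (mul_le_mul_of_nonneg_right (le_abs_self _) hpos.le)
        exact (mul_le_of_le_one_left (norm_nonneg _) (f.le_one j x)).trans h2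
      · rw [image_eq_zero_of_notMem_tsupport hxj, zero_mul]
        positivity
    calc _ ≤ ∑ j, |C j| * h := norm_sum_le_of_le _ fun j _ => hterm j
      _ = (∑ j, |C j|) * h := by rw [Finset.sum_mul]
      _ ≤ (∑ j, |C j| + 1) * h := by
        apply mul_le_mul_of_nonneg_right _ hpos.le
        linarith

end IsAtlas

/-! ### The atlas of a compatible cover -/

theorem limitPoints_mono {L L' : ℝ → Set Plane} {I : Set ℝ} (h : ∀ t, L t ⊆ L' t) :
    limitPoints L I ⊆ limitPoints L' I := by
  intro c hc ε hε
  obtain ⟨t, ht, hlt, x, hx, hd⟩ := hc ε hε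
  exact ⟨t, ht, hlt, x, h t hx, hd⟩

theorem IsSeparatedFamily.neBot {L : ℝ → Set Plane} {I : Set ℝ} {B : Set Plane}
    (h : IsSeparatedFamily L I B) : (𝓝[I] (0 : ℝ)).NeBot :=
  NeBot.mono h.I_accPt (inf_le_inf_right _ nhdsWithin_le_nhds)

/-- A set of the form `G₀(K)`, with `K` convex and meeting the axis, contains a connected set of
limit points. -/
theorem ChartData.IsChart.isConnected_inter_limitPoints {X : ChartData} {L : ℝ → Set Plane}
    {I : Set ℝ} {B V K : Set Plane} (hX : X.IsChart upperIndices L I B) (hI : I ⊆ Ioi 0)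
    [(𝓝[I] (0 : ℝ)).NeBot] (hB : IsOpen B) (hKB : K ⊆ X.principalPreimage B) (hK : Convex ℝ K)
    (hne : ∃ ξ ∈ K, ξ 1 = 0) (hV : X.g 0 '' K = V) : IsConnected (V ∩ limitPoints L I) := by
  have himg : V ∩ limitPoints L I = X.g 0 '' (K ∩ upperHalf) := by
    rw [← hV]
    have hmem : ∀ ξ ∈ K, (X.g 0 ξ ∈ limitPoints L I ↔ ξ ∈ upperHalf) := by
      intro ξ hξ
      rw [hX.mem_limitPoints_iff hI isIndexModel_upper (hB.mem_nhds (hKB hξ).2),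
        hX.coord_g (hKB hξ).1]
    ext x
    constructor
    · rintro ⟨⟨ξ, hξ, rfl⟩, hx⟩
      exact ⟨ξ, ⟨hξ, (hmem ξ hξ).1 hx⟩, rfl⟩
    · rintro ⟨ξ, hξ, rfl⟩
      exact ⟨⟨ξ, hξ.1, rfl⟩, (hmem ξ hξ.1).2 hξ.2⟩
  rw [himg]
  obtain ⟨ξ, hξ, hξ0⟩ := hne
  have hconn : IsConnected (K ∩ upperHalf) :=
    ⟨⟨ξ, hξ, hξ0.ge⟩, (hK.inter isIndexModel_upper.convex).isPreconnected⟩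
  refine hconn.image _ ?_
  exact (hX.contDiffOn_g 0).continuousOn.mono fun η hη => (hKB hη.1).1

theorem ChartData.IsChart.subset_limitPoints {X : ChartData} {L : ℝ → Set Plane}
    {I : Set ℝ} {B : Set Plane} (hX : X.IsChart univ L I B) (hI : I ⊆ Ioi 0)
    [(𝓝[I] (0 : ℝ)).NeBot] (hB : IsOpen B) : B ⊆ limitPoints L I := fun _ hx =>
  (hX.mem_limitPoints_iff hI isIndexModel_univ (hB.mem_nhds hx)).2 trivial

theorem ChartData.IsChart.principalPreimage_image {X : ChartData} {Λ : Set (Fin 2 → ℤ)}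
    {L : ℝ → Set Plane} {I : Set ℝ} {B K : Set Plane} (hX : X.IsChart Λ L I B) (hK : K ⊆ X.U) :
    X.principalPreimage (X.g 0 '' K) = K := by
  ext ξ
  constructor
  · rintro ⟨hξ, η, hη, he⟩
    rwa [← hX.injOn (hK hη) hξ he]
  · exact fun hξ => ⟨hK hξ, mem_image_of_mem _ hξ⟩

namespace IsCompatibleCover

variable {I : Set ℝ} {p q : ℕ} {B : Fin q → Set Plane} {L : Fin q → ℝ → Set Plane}

theorem isSeparatedFamily (hB : IsCompatibleCover I p B L) (i : Fin q) :
    IsSeparatedFamily (L i) I (B i) := by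
  rcases lt_or_ge (i : ℕ) p with hi | hi
  · exact (hB.lattice i hi).1
  · exact (hB.halfLattice i hi).1

/-- On the intersection of two sets of the cover, the limit points of both families coincide. -/
theorem mem_limitPoints_of_mem (hB : IsCompatibleCover I p B L) {i j : Fin q} {x : Plane}
    (hi : x ∈ B i) (hj : x ∈ B j) (hx : x ∈ limitPoints (L j) I) : x ∈ limitPoints (L i) I := by
  intro ε hε
  obtain ⟨r, hr, hball⟩ := Metric.isOpen_iff.1 (hB.isSeparatedFamily i).isOpen x hi
  obtain ⟨h, hh, hlt, y, hy, hd⟩ := hx (min ε r) (lt_min hε hr)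
  have hy' : y ∈ L i h ∩ B j := by
    rw [hB.agree i j ⟨x, hi, hj⟩ h hh]
    exact ⟨hy, hball (hd.trans_le (min_le_right _ _))⟩
  exact ⟨h, hh, hlt.trans_le (min_le_left _ _), y, hy'.1, hd.trans_le (min_le_left _ _)⟩

theorem mem_limitPoints_of_lt (hB : IsCompatibleCover I p B L) {i j : Fin q} (hjp : (j : ℕ) < p)
    {x : Plane} (hi : x ∈ B i) (hj : x ∈ B j) : x ∈ limitPoints (L i) I := by
  obtain ⟨X, hX⟩ := (hB.lattice j hjp).2
  have := (hB.isSeparatedFamily j).neBot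
  exact hB.mem_limitPoints_of_mem hi hj (hX.subset_limitPoints (hB.isSeparatedFamily j).I_pos
    (hB.isSeparatedFamily j).isOpen hj)

theorem isConnected_inter (hB : IsCompatibleCover I p B L) {i j : Fin q}
    (hij : (B i ∩ B j).Nonempty) : IsConnected (B i ∩ B j ∩ limitPoints (L i) I) := by
  have hconn : IsConnected (B i ∩ B j) :=
    (hB.inter_simplyConnected i j hij).isPathConnected.isConnected
  by_cases h : (i : ℕ) < p ∨ (j : ℕ) < p
  · rw [inter_eq_left.2]
    · exact hconn
    · rintro x ⟨hxi, hxj⟩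
      rcases h with h | h
      · exact hB.mem_limitPoints_of_lt h hxi hxi
      · exact hB.mem_limitPoints_of_lt h hxi hxj
  · simp only [not_or, not_lt] at h
    obtain ⟨X, hX, K, hKB, hK, hne, hV⟩ := hB.inter_admissible i j h.1 h.2 hij
    have := (hB.isSeparatedFamily i).neBot
    exact hX.1.isConnected_inter_limitPoints (hB.isSeparatedFamily i).I_pos
      (hB.isSeparatedFamily i).isOpen hKB hK hne hV

/-- The charts of a compatible cover, chosen so that they show the shrunken sets of half-lattices
as convex sets, form an atlas. -/
theorem exists_isAtlas {B' : Fin q → Set Plane} (hB : IsCompatibleCover I p B L)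
    (hTriple : ∀ i j k : Fin q, p ≤ (i : ℕ) → p ≤ (j : ℕ) → p ≤ (k : ℕ) →
      (B i ∩ B j ∩ B k).Nonempty → (B i ∩ B j ∩ B k ∩ limitPoints (L i) I).Nonempty)
    (hB' : IsCompatibleCover I p B' (fun i => restrictFamily (L i) (B' i)))
    (hsub : ∀ i, RelCompactIn (B' i) (B i))
    (hadm : ∀ i : Fin q, p ≤ (i : ℕ) → IsAdmissibleDomain (L i) I (B i) (B' i)) :
    ∃ (X : Fin q → ChartData) (Λ : Fin q → Set (Fin 2 → ℤ)) (H : Fin q → Set Plane),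
      IsAtlas I B B' L X Λ H ∧ (∀ i : Fin q, (i : ℕ) < p → Λ i = univ) ∧
      ∀ i : Fin q, p ≤ (i : ℕ) → Λ i = upperIndices ∧
        Convex ℝ ((X i).principalPreimage (B' i)) ∧
        ∃ ξ ∈ (X i).principalPreimage (B' i), ξ 1 = 0 := by
  obtain ⟨x₀, hx₀⟩ := hB.union_simplyConnected.nonempty
  obtain ⟨i₀, -⟩ := mem_iUnion.1 hx₀
  have hI := (hB.isSeparatedFamily i₀).I_pos
  have := (hB.isSeparatedFamily i₀).neBot
  have hBB : ∀ i, B' i ⊆ B i := fun i => subset_closure.trans (hsub i).2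
  have hex : ∀ i : Fin q, ∃ (X : ChartData) (Λ : Set (Fin 2 → ℤ)) (H : Set Plane),
      X.IsChart Λ (L i) I (B i) ∧ IsIndexModel Λ H ∧
      IsConnected (B' i ∩ limitPoints (L i) I) ∧
      X.IsNear (L i) I (B' i ∩ limitPoints (L i) I) (B' i) ∧ ((i : ℕ) < p → Λ = univ) ∧
      (p ≤ (i : ℕ) → Λ = upperIndices ∧ Convex ℝ (X.principalPreimage (B' i)) ∧
        ∃ ξ ∈ X.principalPreimage (B' i), ξ 1 = 0) := by
    intro i
    rcases lt_or_ge (i : ℕ) p with hi | hi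
    · obtain ⟨X, hX⟩ := (hB.lattice i hi).2
      have hlim : B' i ∩ limitPoints (L i) I = B' i := inter_eq_left.2 fun x hx =>
        hB.mem_limitPoints_of_lt hi (hBB i hx) (hBB i hx)
      refine ⟨X, univ, univ, hX, isIndexModel_univ, ?_, ?_, fun _ => rfl,
        fun h => absurd hi (not_lt.2 h)⟩
      · rw [hlim]
        exact (hB'.isSeparatedFamily i).simplyConnected.isPathConnected.isConnected
      · rw [hlim]
        exact ⟨0, Eventually.of_forall fun h x hx => ⟨x, hx.2, by simp⟩⟩
    · obtain ⟨X, hX, K, hKB, hK, hne, hV⟩ := hadm i hi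
      have hpre : X.principalPreimage (B' i) = K := by
        rw [← hV]
        exact hX.1.principalPreimage_image fun ξ hξ => (hKB hξ).1
      rw [← hpre] at hK hne
      refine ⟨X, upperIndices, upperHalf, hX.1, isIndexModel_upper, ?_, ?_,
        fun h => absurd h (not_lt.2 hi), fun _ => ⟨rfl, hK, hne⟩⟩
      · rw [hpre] at hK hne
        exact hX.1.isConnected_inter_limitPoints hI (hB.isSeparatedFamily i).isOpen hKB hK hne hV
      · exact hX.1.isNear_of_convex hI (hB.isSeparatedFamily i).isBounded
          (hB'.isSeparatedFamily i).isOpen (hBB i) hK hne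
  choose X Λ H hX hΛ hconn hnear hlat hhalf using hex
  refine ⟨X, Λ, H, ?_, hlat, hhalf⟩
  exact {
    pos := hI
    neBot := this
    chart := hX
    model := hΛ
    isOpen := fun i => (hB.isSeparatedFamily i).isOpen
    isBounded := fun i => (hB.isSeparatedFamily i).isBounded
    nonempty := fun i => (hB.isSeparatedFamily i).simplyConnected.nonempty
    preconnected := fun i =>
      (hB.isSeparatedFamily i).simplyConnected.isPathConnected.isConnected.isPreconnected
    union_simplyConnected := hB.union_simplyConnected
    family_subset := fun i => (hB.isSeparatedFamily i).subset
    agree := hB.agree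
    connected_inter := fun i j hij => hB.isConnected_inter hij
    triple := fun i j k hijk => by
      by_cases h : p ≤ (i : ℕ) ∧ p ≤ (j : ℕ) ∧ p ≤ (k : ℕ)
      · exact hTriple i j k h.1 h.2.1 h.2.2 hijk
      · obtain ⟨x, hx⟩ := hijk
        refine ⟨x, hx, ?_⟩
        simp only [not_and_or, not_le] at h
        rcases h with h | h | h
        · exact hB.mem_limitPoints_of_lt h hx.1.1 hx.1.1
        · exact hB.mem_limitPoints_of_lt h hx.1.1 hx.1.2
        · exact hB.mem_limitPoints_of_lt h hx.1.1 hx.2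
    isOpen' := fun i => (hB'.isSeparatedFamily i).isOpen
    nonempty' := fun i => (hB'.isSeparatedFamily i).simplyConnected.nonempty
    union_preconnected' := hB'.union_simplyConnected.isPathConnected.isConnected.isPreconnected
    closure_subset := fun i => (hsub i).2
    connected' := hconn
    near' := hnear
    overlap' := fun i j hij => by
      obtain ⟨x, hx⟩ := (hB'.isConnected_inter hij).nonempty
      exact ⟨x, hx.1, limitPoints_mono (fun h => inter_subset_left) hx.2⟩ }

end IsCompatibleCover

theorem theorem4p20 (I : Set ℝ) (p q : ℕ)
    (B B' : Fin q → Set Plane) (L : Fin q → ℝ → Set Plane)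
    (hB : IsCompatibleCover I p B L)
    (hTriple : ∀ i j k : Fin q, p ≤ (i : ℕ) → p ≤ (j : ℕ) → p ≤ (k : ℕ) →
      (B i ∩ B j ∩ B k).Nonempty → (B i ∩ B j ∩ B k ∩ limitPoints (L i) I).Nonempty)
    (hB' : IsCompatibleCover I p B' (fun i => restrictFamily (L i) (B' i)))
    (hsub : ∀ i, RelCompactIn (B' i) (B i))
    (hadm : ∀ i : Fin q, p ≤ (i : ℕ) → IsAdmissibleDomain (L i) I (B i) (B' i)) :
    -- existence; moreover `ℓ` can be chosen so that the vectors `ν_h` below are integral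
    (∃ ℓ : ℝ → Plane → (Fin 2 → ℤ), IsGlobalLabelling I p B' L ℓ ∧
      ∃ (Φ : Plane → Plane) (n : ℝ → (Fin 2 → ℤ)),
        IsSmoothNear Φ (closure (⋃ i, B i)) ∧
        ApproximatesLabelling I (fun h => (⋃ i, L i h) ∩ ⋃ i, B' i) ℓ Φ
          (fun h => scaledPoint 1 (n h))) ∧
    -- uniqueness, given the restriction to any one piece
    (∀ ℓ ℓ' : ℝ → Plane → (Fin 2 → ℤ),
      IsGlobalLabelling I p B' L ℓ → IsGlobalLabelling I p B' L ℓ' →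
      ∀ i : Fin q, AgreeForSmall I (fun h => L i h ∩ B' i) ℓ ℓ' →
        AgreeForSmall I (fun h => (⋃ i, L i h) ∩ ⋃ i, B' i) ℓ ℓ') ∧
    -- approximation of every global labelling by a smooth map
    (∀ ℓ : ℝ → Plane → (Fin 2 → ℤ), IsGlobalLabelling I p B' L ℓ →
      ∃ (Φ : Plane → Plane) (ν : ℝ → Plane),
        IsSmoothNear Φ (closure (⋃ i, B i)) ∧
        ApproximatesLabelling I (fun h => (⋃ i, L i h) ∩ ⋃ i, B' i) ℓ Φ ν) := by
  obtain ⟨X, Λ, H, T, hlat, hhalf⟩ := hB.exists_isAtlas hTriple hB' hsub hadm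
  obtain ⟨ℓ₀, hℓ₀, A, r, happrox⟩ := T.exists_isGlobalLabelling hlat hhalf
  obtain ⟨Φ, hΦ, K, hK, hbound⟩ := T.exists_contDiff_approx happrox
  refine ⟨⟨ℓ₀, hℓ₀, Φ, fun _ => 0, ⟨univ, isOpen_univ, subset_univ _, hΦ.contDiffOn⟩, K, hK,
    exists_forall_le_of_eventually T.pos ?_⟩, fun ℓ ℓ' hℓ hℓ' i h => ?_, fun ℓ hℓ => ?_⟩
  · filter_upwards [hbound] with h hh x hx
    have e : scaledPoint 1 0 = 0 := by ext i; simp [scaledPoint]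
    rw [e, sub_zero]
    exact hh x hx
  · exact T.agreeForSmall (T.isPiecewiseAffine_of_isGlobalLabelling hℓ)
      (T.isPiecewiseAffine_of_isGlobalLabelling hℓ') h
  · obtain ⟨P, κ, hP⟩ := T.exists_affine_relation (T.isPiecewiseAffine_of_isGlobalLabelling hℓ₀)
      (T.isPiecewiseAffine_of_isGlobalLabelling hℓ)
    refine ⟨fun x => intMap P.1 (Φ x), fun h => -scaledPoint h (κ h),
      ⟨univ, isOpen_univ, subset_univ _, ((intMap P.1).contDiff.comp hΦ).contDiffOn⟩,
      ‖intMap P.1‖ * K + 1, by positivity, exists_forall_le_of_eventually T.pos ?_⟩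
    filter_upwards [hbound, hP, self_mem_nhdsWithin] with h h1 h2 hh x hx
    have hpos : 0 < h := T.pos hh
    have e : intMap P.1 (Φ x) - scaledPoint h (ℓ h x) - -scaledPoint h (κ h)
        = intMap P.1 (Φ x - scaledPoint h (ℓ₀ h x)) := by
      rw [h2 x hx, map_sub, intMap_scaledPoint]
      simp only [scaledPoint_eq_smul, intPoint_add, smul_add]
      abel
    rw [e]
    calc _ ≤ ‖intMap P.1‖ * (K * h) := ((intMap P.1).le_opNorm _).trans
          (mul_le_mul_of_nonneg_left (h1 x hx) (norm_nonneg _))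
      _ ≤ (‖intMap P.1‖ * K + 1) * h := by linarith
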